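/- **Polytope numbers.** Let $P\subset\mathbb R^m$ be a polytope and choose for every nonempty face $F$ of $P$ a vertex $\mathbf v_F$ of $F$ (its apex). The polytope numbers $P(n)$ and interior polytope numbers $P(n)^\sharp$, $n\ge 0$, are defined by induction on dimension and $n$. If $\dim P=0$, then $P(0)=P(0)^\sharp=0$ and $P(n)=P(n)^\sharp=1$ for $n\ge1$. If $\dim P\ge1$, then $P(0)=P(0)^\sharp=0$, $P(1)=1$, $P(1)^\sharp=0$, and for $n\ge2$ $$P(n)=P(n-1)+\sum_{\mathbf v_P\notin F}F(n)^\sharp,\qquad P(n)^\sharp=P(n)-\sum_{F\ne P}F(n)^\sharp,$$ the sums being over nonempty faces $F$ of $P$. **Pointed triangulations.** A pointed triangulation of $P$ with apexes $(\mathbf v_F)$ is a triangulation $\mathcal C$ of $P$ (a finite geometric simplicial complex with union $P$) such that: (1) for each nonempty face $F$ of $P$ the simplices of $\mathcal C$ contained in $F$ triangulate $F$, and each maximal one of them contains $\mathbf v_F$; (2) if $\mathbf v_F,\mathbf v_G\in F\cap G$ for two faces $F,G$, then $\mathbf v_F=\mathbf v_G$; (3) for each face $F$ and each vertex $\mathbf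 w\ne\mathbf v_F$ of $F$, the segment $[\mathbf v_F,\mathbf w]$ is an edge of $\mathcal C$; and (4) the apexes are given by a linear form $c$ that takes distinct values at distinct vertices of $P$: $\mathbf v_F$ minimizes $c$ on $F$. Let $\alpha^d(n)$ denote the polytope numbers of the standard $d$-simplex, with any choice of apexes, where $\alpha^d(k)=0$ for $k\le0$. Then the following hold. 1. **Cross polytope.** Let $d\ge1$ and $\beta^d=\mathrm{conv}\{\pm\mathbf e_1,\dots,\pm\mathbf e_d\}\subset\mathbb R^d$. The simplices with vertex sets $\{\mathbf e_d,-\mathbf e_d,a_1\mathbf e_1,\dots,a_{d-1}\mathbf e_{d-1}\}$, $a_i\in\{1,-1\}$, are the maximal simplices of a pointed triangulation of $\beta^d$ (for some choice of apexes). For every choice of apexes of $\beta^d$ (in particular that of this triangulation) and every $n\ge0$, $$\beta^d(n)=\sum_{i=0}^{d-1}\binom{d-1}{i}\,\alpha^d(n-i).$$ 2. **Measure polytope.** Let $d\ge1$ and $\gamma^d=\prod_{i=1}^d[a_i,b_i]$ with $a_i<b_i$ (for instance $[0,1]^d$ or $[-1,1]^d$). For a permutation $\sigma$ of $\{1,\dots,d\}$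 let $\mathbf v_k^\sigma$, $0\le k\le d$, be the vertex of $\gamma^d$ whose $j$-th coordinate is $b_j$ for $j\in\{\sigma(1),\dots,\sigma(k)\}$ and $a_j$ otherwise. The simplices with vertex sets $\{\mathbf v_0^\sigma,\dots,\mathbf v_d^\sigma\}$ are the maximal simplices of a pointed triangulation of $\gamma^d$ (for some choice of apexes). For every choice of apexes of $\gamma^d$ and every $n\ge0$, $$\gamma^d(n)=\sum_{i=0}^{d-1}\left\langle{d\atop i}\right\rangle\alpha^d(n-i),$$ where the Eulerian number $\left\langle{d\atop i}\right\rangle$ is the number of permutations of $\{1,\dots,d\}$ with exactly $i$ descents. 3. **Products of simplices.** Let $d_1,\dots,d_l\ge0$ be integers with $d=d_1+\dots+d_l\ge1$, and let $\alpha^{d_1,\dots,d_l}=\prod_{j=1}^l\alpha^{d_j}$, where $\alpha^{d_j}$ is the standard simplex with vertices $\mathbf e^j_0,\dots,\mathbf e^j_{d_j}$ in $\mathbb R^{d_j+1}$. For a permutation $w=[w_1,\dots,w_d]$ of the multiset $\{1^{d_1},\dots,l^{d_l}\}$ and $0\le i\le d$ let $\mathbf v^w_i=(\mathbf e^1_{A^1_i},\dots,\mathbf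 e^l_{A^l_i})$, where $A^j_i=|\{k\le i: w_k=j\}|$. The simplices with vertex sets $\{\mathbf v^w_0,\dots,\mathbf v^w_d\}$ are the maximal simplices of a pointed triangulation of $\alpha^{d_1,\dots,d_l}$ (for some choice of apexes). For every choice of apexes of $\alpha^{d_1,\dots,d_l}$ and every $n\ge0$, $$\alpha^{d_1,\dots,d_l}(n)=\sum_{i=0}^{d-1}\left\langle{d_1,\dots,d_l\atop i}\right\rangle\alpha^d(n-i),$$ where the generalized Eulerian number $\left\langle{d_1,\dots,d_l\atop i}\right\rangle$ is the number of permutations $w$ of the multiset $\{1^{d_1},\dots,l^{d_l}\}$ with exactly $i$ descents, i.e. with exactly $i$ indices $k$ such that $w_k>w_{k+1}$. -/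

import Mathlib

open Finset

section Faces

variable {E : Type*} [AddCommGroup E] [Module ℝ E] [TopologicalSpace E]

/-- The dimension of a (nonempty) polytope: the dimension of its affine hull. -/
noncomputable def polytopeDim (P : Set E) : ℕ := Module.finrank ℝ (vectorSpan ℝ P)

/-- `F` is a nonempty face of `P`: the set of maximizers on `P` of some linear form
(the zero form gives `P` itself). -/
def IsFace (P F : Set E) : Prop := IsExposed ℝ P F ∧ F.Nonempty

/-- A nonempty face of `P` other than `P`. -/
def IsProperFace (P F : Set E) : Prop := IsFace P F ∧ F ≠ P

/-- `V` designates for every nonempty face `F` of `P` a vertex `V F` of `F`, the apex of `F`. -/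
def IsApexAssignment (P : Set E) (V : Set E → E) : Prop :=
  ∀ F, IsFace P F → V F ∈ F.extremePoints ℝ

theorem polytopeDim_lt_of_isProperFace [FiniteDimensional ℝ E] {P F : Set E}
    (h : IsProperFace P F) : polytopeDim F < polytopeDim P := by
  obtain ⟨⟨hexp, hne⟩, hFP⟩ := h
  have hsub : F ⊆ P := hexp.subset
  obtain ⟨l, hl⟩ := hexp hne
  obtain ⟨x₀, hx₀⟩ := hne
  have hx₀' := hx₀
  rw [hl] at hx₀'
  obtain ⟨y, hyP, hyF⟩ := Set.exists_of_ssubset (hsub.ssubset_of_ne hFP)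
  apply Submodule.finrank_lt_finrank_of_lt
  refine lt_of_le_of_ne (vectorSpan_mono ℝ hsub) fun heq => ?_
  have hker : vectorSpan ℝ F ≤ LinearMap.ker (l : E →ₗ[ℝ] ℝ) := by
    rw [vectorSpan_def, Submodule.span_le]
    rintro _ ⟨a, ha, b, hb, rfl⟩
    rw [hl] at ha hb
    have h1 := ha.2 b hb.1
    have h2 := hb.2 a ha.1
    simp only [SetLike.mem_coe, LinearMap.mem_ker, vsub_eq_sub, map_sub,
      ContinuousLinearMap.coe_coe]
    linarith
  have hmem : y -ᵥ x₀ ∈ vectorSpan ℝ F :=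
    heq ▸ vsub_mem_vectorSpan ℝ hyP (hsub hx₀)
  have h0 := hker hmem
  simp only [LinearMap.mem_ker, vsub_eq_sub, map_sub, ContinuousLinearMap.coe_coe] at h0
  apply hyF
  rw [hl]
  refine ⟨hyP, fun z hz => ?_⟩
  have h3 := hx₀'.2 z hz
  linarith

end Faces

section PolytopeNumbers

open Classical in
/-- The pair `(P(n), P(n)^♯)` of the `n`-th polytope number and the `n`-th interior polytope
number of `P` with respect to the apexes `V`, by double induction on `dim P` and `n`.
* `dim P = 0`: both sequences are `0, 1, 1, 1, …`.
* `dim P ≥ 1`: `P(0) = 0`, `P(1) = 1`, `P(0)^♯ = P(1)^♯ = 0`, and for `n ≥ 2`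
  `P(n) = P(n - 1) + ∑ F(n)^♯` over the faces `F` of `P` that do not contain the apex of `P`
  (all of them proper faces), `P(n)^♯ = P(n) - ∑ F(n)^♯` over all proper faces `F` of `P`. -/
noncomputable def polytopeNumberPair {E : Type*} [AddCommGroup E] [Module ℝ E] [TopologicalSpace E]
    [FiniteDimensional ℝ E] (V : Set E → E) (P : Set E)
    (n : ℕ) : ℤ × ℤ :=
  if polytopeDim P = 0 then
    (if n = 0 then (0, 0) else (1, 1))
  else match n with
    | 0 => (0, 0)
    | 1 => (1, 0)
    | m + 2 =>
      let N : ℤ := (polytopeNumberPair V P (m + 1)).1 +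
        ∑ᶠ F : {F : Set E // IsProperFace P F},
          if V P ∈ F.1 then 0 else (polytopeNumberPair V F.1 (m + 2)).2
      (N, N - ∑ᶠ F : {F : Set E // IsProperFace P F}, (polytopeNumberPair V F.1 (m + 2)).2)
termination_by (polytopeDim P, n)
decreasing_by
  · exact Prod.Lex.right _ (Nat.lt_succ_self _)
  · exact Prod.Lex.left _ _ (polytopeDim_lt_of_isProperFace F.2)
  · exact Prod.Lex.left _ _ (polytopeDim_lt_of_isProperFace F.2)

/-- The polytope number `P(n)` with respect to the apexes `V`. -/
noncomputable def polytopeNumber {E : Type*} [AddCommGroup E] [Module ℝ E] [TopologicalSpace E]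
    [FiniteDimensional ℝ E] (V : Set E → E) (P : Set E)
    (n : ℕ) : ℤ :=
  (polytopeNumberPair V P n).1

/-- The triangulation `K` of the polytope `P` is a pointed triangulation with apexes `V`. -/
structure IsPointedTriangulation {E : Type*} [AddCommGroup E] [Module ℝ E]
    [TopologicalSpace E] (P : Set E) (V : Set E → E)
    (K : Geometry.SimplicialComplex ℝ E) : Prop where
  finite_faces : K.faces.Finite
  /-- `K` is a triangulation of `P`. -/
  space_eq : K.space = P
  /-- The apex of each face is a vertex of that face. -/
  apex : IsApexAssignment P V
  /-- The simplices of `K` lying in a face `F` triangulate `F`. -/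
  face_space : ∀ F, IsFace P F → ∀ x ∈ F, ∃ s ∈ K.faces,
    convexHull ℝ (s : Set E) ⊆ F ∧ x ∈ convexHull ℝ (s : Set E)
  /-- Every maximal simplex of the triangulation of a face `F` (these are its simplices of
  dimension `dim F`) contains the apex of `F`. -/
  apex_mem : ∀ F, IsFace P F → ∀ s ∈ K.faces, convexHull ℝ (s : Set E) ⊆ F →
    (∀ t ∈ K.faces, convexHull ℝ (t : Set E) ⊆ F → s ⊆ t → t = s) → V F ∈ s
  /-- Two faces whose apexes both lie in both faces have the same apex. -/
  apex_eq : ∀ F G, IsFace P F → IsFace P G → V F ∈ F ∩ G → V G ∈ F ∩ G → V F = V G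
  /-- In each face the segment from the apex to any other vertex is an edge of `K`. -/
  edge : ∀ F, IsFace P F → ∀ w ∈ F.extremePoints ℝ, w ≠ V F →
    ∃ s ∈ K.faces, (s : Set E) = {V F, w}
  /-- The apexes come from a linear form in general position, that is, one that separates the
  vertices of `P`: the apex of a face minimizes the form on that face. -/
  linear_form : ∃ c : E →ₗ[ℝ] ℝ, Set.InjOn c (P.extremePoints ℝ) ∧
    ∀ F, IsFace P F → ∀ x ∈ F, c (V F) ≤ c x

end PolytopeNumbers

section Polytopes

/-- The standard `d`-cross polytope, the convex hull of `±e_1, …, ±e_d` in `ℝ^d`. -/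
def crossPolytope (d : ℕ) : Set (Fin d → ℝ) :=
  convexHull ℝ (Set.range (fun i => Pi.single i 1) ∪ Set.range (fun i => -Pi.single i 1))

/-- For signs `a_1, …, a_d`, the vertex set `{e_{d+1}, -e_{d+1}, a_1 e_1, …, a_d e_d}` in
`ℝ^{d+1}`. -/
noncomputable def crossSimplex {d : ℕ} (a : Fin d → ℤˣ) : Finset (Fin (d + 1) → ℝ) :=
  {Pi.single (Fin.last d) 1, -Pi.single (Fin.last d) 1} ∪
    univ.image fun i => Pi.single i.castSucc ((a i : ℤ) : ℝ)

/-- The product of the segments `[a_i, b_i]`; the `d`-measure polytopes are these with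
`a_i < b_i` for all `i`. -/
def measurePolytope {d : ℕ} (a b : Fin d → ℝ) : Set (Fin d → ℝ) :=
  Set.univ.pi fun i => Set.Icc (a i) (b i)

/-- For a permutation `σ`, the vertex set `v_0, v_1, …, v_d` of vertices of the measure polytope, where
`v_0 = a` and `v_{k+1}` is obtained from `v_k` by changing coordinate `σ k` from its value in `a`
to its value in `b`. For `a = 0`, `b = 1` this is
`v_k = e_{σ 0} + ⋯ + e_{σ (k-1)}`. -/
noncomputable def boxSimplex {d : ℕ} (a b : Fin d → ℝ) (σ : Equiv.Perm (Fin d)) :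
    Finset (Fin d → ℝ) :=
  univ.image fun k : Fin (d + 1) => fun j => if (σ.symm j : ℕ) < k then b j else a j

/-- The product of the standard simplices of dimensions `d_1, …, d_l`, where the standard
`m`-simplex lies in `ℝ^{m+1}`. -/
def simplexProduct {l : ℕ} (d : Fin l → ℕ) : Set ((j : Fin l) → Fin (d j + 1) → ℝ) :=
  Set.univ.pi fun j => stdSimplex ℝ (Fin (d j + 1))

/-- `w` is a permutation of the multiset in which `j` has multiplicity `d j`. -/
def IsMultisetPerm {l : ℕ} (d : Fin l → ℕ) (w : Fin (∑ j, d j) → Fin l) : Prop :=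
  ∀ j, #{k | w k = j} = d j

/-- The vertex set `v_0, v_1, …, v_d` (`d = d_1 + ⋯ + d_l`) of vertices of the product of
simplices, where the `j`-th component of `v_i` is the unit vector of index
`A = #{k < i : w k = j}`. -/
noncomputable def productSimplex {l : ℕ} (d : Fin l → ℕ) (w : Fin (∑ j, d j) → Fin l) :
    Finset ((j : Fin l) → Fin (d j + 1) → ℝ) :=
  univ.image fun i : Fin ((∑ j, d j) + 1) => fun j m =>
    if (m : ℕ) = #{k : Fin (∑ j, d j) | (k : ℕ) < i ∧ w k = j} then 1 else 0

end Polytopes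

section Eulerian

/-- The number of descents of a word, i.e. of indices `k` with `w k > w (k + 1)`. -/
def descentCount {m l : ℕ} (w : Fin m → Fin l) : ℕ :=
  #{p : Fin m × Fin m | (p.2 : ℕ) = p.1 + 1 ∧ w p.2 < w p.1}

/-- The Eulerian number: the number of permutations of `d` letters with `i` descents. -/
def eulerianNumber (d i : ℕ) : ℕ :=
  #{σ : Equiv.Perm (Fin d) | descentCount σ = i}

open Classical in
/-- The generalized Eulerian number: the number of permutations of the multiset
`{1^{d_1}, …, l^{d_l}}` with `i` descents. -/
noncomputable def generalizedEulerianNumber {l : ℕ} (d : Fin l → ℕ) (i : ℕ) : ℕ :=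
  #{w : Fin (∑ j, d j) → Fin l | IsMultisetPerm d w ∧ descentCount w = i}

end Eulerian

section Triangulations

variable {E : Type*} [AddCommGroup E] [Module ℝ E]

theorem IsFace.exists_eq [TopologicalSpace E] {P F : Set E} (h : IsFace P F) :
    ∃ l : E →ₗ[ℝ] ℝ, F = {x ∈ P | ∀ y ∈ P, l y ≤ l x} := by
  obtain ⟨l, hl⟩ := h.1 h.2
  exact ⟨l, hl⟩

theorem IsFace.convex [TopologicalSpace E] {P F : Set E} (h : IsFace P F) (hP : Convex ℝ P) : Convex ℝ F := by
  obtain ⟨l, rfl⟩ := h.exists_eq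
  intro x hx y hy a b ha hb hab
  refine ⟨hP hx.1 hy.1 ha hb hab, fun z hz => ?_⟩
  have h1 := hx.2 z hz
  have h2 := hy.2 z hz
  simp only [map_add, map_smul, smul_eq_mul]
  calc l z = a * l z + b * l z := by rw [← add_mul, hab, one_mul]
    _ ≤ _ := by gcongr

theorem IsFace.mem_of_sum_mem [TopologicalSpace E] {X : Type*} [Fintype X] {P F : Set E} (h : IsFace P F) {v : X → E}
    (hv : ∀ x, v x ∈ P) {μ : X → ℝ} (h0 : 0 ≤ μ) (h1 : ∑ x, μ x = 1)
    (hF : ∑ x, μ x • v x ∈ F) {a : X} (ha : μ a ≠ 0) : v a ∈ F := by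
  obtain ⟨l, rfl⟩ := h.exists_eq
  set z := ∑ x, μ x • v x with hz
  have hs : ∑ x, μ x * (l z - l (v x)) = 0 := by
    simp only [mul_sub, sum_sub_distrib, ← sum_mul, h1, one_mul]
    rw [hz, map_sum]
    simp
  rw [sum_eq_zero_iff_of_nonneg
    fun x _ => mul_nonneg (h0 x) (sub_nonneg.2 (hF.2 _ (hv x)))] at hs
  have h2 := (mul_eq_zero.1 (hs a (mem_univ a))).resolve_left ha
  exact ⟨hv a, fun y hy => (hF.2 y hy).trans (by linarith)⟩

theorem IsFace.mem_of_midpoint_mem [TopologicalSpace E] {P F : Set E} (h : IsFace P F) {x y z w : E} (hx : x ∈ P)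
    (hy : y ∈ P) (hz : z ∈ F) (hw : w ∈ F) (he : x + y = z + w) : x ∈ F := by
  obtain ⟨l, rfl⟩ := h.exists_eq
  refine ⟨hx, fun u hu => ?_⟩
  have h1 := hz.2 u hu
  have h2 := hw.2 y hy
  have h3 := congrArg l he
  simp only [map_add] at h3
  linarith

theorem IsFace.exists_eq_of_mem_extremePoints [TopologicalSpace E] {X : Type*} [Fintype X]
    {P F : Set E} (hF : IsFace P F) (hP : Convex ℝ P) {v : X → E} (hv : ∀ x, v x ∈ P) {μ : X → ℝ}
    (h0 : 0 ≤ μ) (h1 : ∑ x, μ x = 1) (hw : ∑ x, μ x • v x ∈ F.extremePoints ℝ) :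
    ∃ a, v a = ∑ x, μ x • v x := by
  have hT : ∑ a, μ a • v a ∈ convexHull ℝ (v '' {a | v a ∈ F}) := by
    classical
    rw [← sum_subset (filter_subset (fun a => μ a ≠ 0) univ) (by simp +contextual)]
    refine (convex_convexHull ℝ _).sum_mem (fun a _ => h0 a) ?_ fun a ha =>
      subset_convexHull ℝ _ ⟨a, hF.mem_of_sum_mem hv h0 h1 hw.1 (by simpa using ha), rfl⟩
    rw [← h1]
    exact sum_subset (filter_subset _ _) (by simp +contextual)
  have hsub : convexHull ℝ (v '' {a | v a ∈ F}) ⊆ F :=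
    convexHull_min (by rintro _ ⟨a, ha, rfl⟩; exact ha) (hF.convex hP)
  obtain ⟨a, -, ha⟩ := extremePoints_convexHull_subset
    (inter_extremePoints_subset_extremePoints_of_subset hsub ⟨hT, hw⟩)
  exact ⟨a, ha⟩

theorem mem_convexHull_image_iff {X : Type*} [Fintype X] [DecidableEq X] [DecidableEq E] {v : X → E}
    (hv : v.Injective) (C : Finset X) (x : E) :
    x ∈ convexHull ℝ (C.image v : Set E) ↔ ∃ μ : X → ℝ, 0 ≤ μ ∧ (∀ a, μ a ≠ 0 → a ∈ C) ∧
      ∑ a, μ a = 1 ∧ ∑ a, μ a • v a = x := by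
  rw [Finset.mem_convexHull']
  constructor
  · rintro ⟨w, h0, h1, hx⟩
    rw [sum_image hv.injOn] at h1 hx
    refine ⟨fun a => if a ∈ C then w (v a) else 0, fun a => ?_, fun a ha => ?_, ?_, ?_⟩
    · by_cases h : a ∈ C
      · simpa [h] using h0 _ (mem_image_of_mem v h)
      · simp [h]
    · by_contra h
      simp [h] at ha
    · simpa using h1
    · simpa [ite_smul] using hx
  · rintro ⟨μ, h0, hC, h1, hx⟩
    refine ⟨fun y => ∑ a, if v a = y then μ a else 0, fun y _ => sum_nonneg fun a _ => ?_, ?_, ?_⟩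
    · split_ifs
      exacts [h0 a, le_rfl]
    all_goals
      rw [sum_image hv.injOn]
      simp only [hv.eq_iff, sum_ite_eq', mem_univ, if_true]
    · rw [← h1]
      exact sum_subset (subset_univ _) fun a _ ha => by_contra fun h => ha (hC a h)
    · rw [← hx]
      refine sum_subset (subset_univ _) fun a _ ha => ?_
      rw [show μ a = 0 from by_contra fun h => ha (hC a h), zero_smul]

/-- Weights supported on a member of `𝒞` are determined by their sum and their barycentre. -/
def HasUniqueWeights {X : Type*} [Fintype X] (v : X → E) (𝒞 : Set (Finset X)) : Prop :=
  ∀ μ ν : X → ℝ, 0 ≤ μ → 0 ≤ ν → ({a | μ a ≠ 0} : Finset X) ∈ 𝒞 → ({a | ν a ≠ 0} : Finset X) ∈ 𝒞 →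
    ∑ a, μ a = ∑ a, ν a → ∑ a, μ a • v a = ∑ a, ν a • v a → μ = ν

theorem HasUniqueWeights.affineIndependent {X : Type*} [Fintype X] [DecidableEq X] [DecidableEq E]
    {v : X → E} {𝒞 : Set (Finset X)} (hu : HasUniqueWeights v 𝒞) (hdown : IsLowerSet 𝒞)
    {C : Finset X} (hC : C ∈ 𝒞) :
    AffineIndependent ℝ ((↑) : C.image v → E) := by
  have key : AffineIndependent ℝ (fun a : C => v a) := by
    rw [affineIndependent_iff_of_fintype]
    intro w hw hs a
    rw [weightedVSub_eq_linear_combination _ hw] at hs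
    let f : X → ℝ := fun a => if h : a ∈ C then w ⟨a, h⟩ else 0
    have hf0 : ∑ a, f a = 0 := by
      rw [← hw, ← sum_subset (subset_univ C) fun a _ ha => by simp [f, ha], ← sum_attach]
      simp [f]
    have hf1 : ∑ a, f a • v a = 0 := by
      rw [← hs, ← sum_subset (subset_univ C) fun a _ ha => by simp [f, ha], ← sum_attach]
      simp [f]
    have hfC : ∀ g : ℝ → ℝ, g 0 = 0 → ({a | g (f a) ≠ 0} : Finset X) ∈ 𝒞 := fun g hg => by
      refine hdown (fun a ha => ?_) hC
      by_contra h
      simp [f, h, hg] at ha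
    have := hu (fun a => (f a)⁺) (fun a => (f a)⁻) (fun a => posPart_nonneg _)
      (fun a => negPart_nonneg _) (hfC (·⁺) (by simp)) (hfC (·⁻) (by simp))
      (by rw [← sub_eq_zero, ← sum_sub_distrib]; simpa using hf0)
      (by rw [← sub_eq_zero, ← sum_sub_distrib]; simpa [← sub_smul] using hf1)
    have h2 : f a = 0 := by
      rw [← posPart_sub_negPart (f a), sub_eq_zero]
      exact congrFun this a
    simpa [f] using h2
  exact key.range.mono fun x hx => by
    obtain ⟨a, ha, rfl⟩ := mem_image.1 (mem_coe.1 hx)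
    exact ⟨⟨a, ha⟩, rfl⟩

/-- The simplicial complex with the simplices `v '' C`, `C ∈ 𝒞`. -/
noncomputable def complexOfWeights {X : Type*} [Fintype X] [DecidableEq X] [DecidableEq E]
    {v : X → E} (hv : v.Injective) {𝒞 : Set (Finset X)} (hdown : IsLowerSet 𝒞)
    (hu : HasUniqueWeights v 𝒞) : Geometry.SimplicialComplex ℝ E where
  faces := {s | ∃ C ∈ 𝒞, C.Nonempty ∧ s = C.image v}
  isRelLowerSet_faces := by
    rintro _ ⟨C, hC, hne, rfl⟩
    refine ⟨hne.image v, fun t ht htne => ?_⟩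
    obtain ⟨D, hD, rfl⟩ := subset_image_iff.1 ht
    exact ⟨D, hdown (by simpa using hD) hC, image_nonempty.1 htne, rfl⟩
  indep := by
    rintro _ ⟨C, hC, -, rfl⟩
    exact hu.affineIndependent hdown hC
  inter_subset_convexHull := by
    rintro _ _ ⟨C, hC, -, rfl⟩ ⟨D, hD, -, rfl⟩ x ⟨hx, hy⟩
    obtain ⟨μ, h0, hμC, h1, hx⟩ := (mem_convexHull_image_iff hv C x).1 hx
    obtain ⟨ν, k0, hνD, k1, hy⟩ := (mem_convexHull_image_iff hv D x).1 hy
    obtain rfl : μ = ν := hu μ ν h0 k0 (hdown (fun a ha => hμC a (by simpa using ha)) hC)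
      (hdown (fun a ha => hνD a (by simpa using ha)) hD) (h1.trans k1.symm) (hx.trans hy.symm)
    rw [← coe_inter, ← image_inter _ _ hv, mem_convexHull_image_iff hv]
    exact ⟨μ, h0, fun a ha => mem_inter.2 ⟨hμC a ha, hνD a ha⟩, h1, hx⟩

theorem mem_extremePoints_of_isMinOn [TopologicalSpace E] {X : Type*} [Fintype X] {P F : Set E}
    (hF : IsFace P F) {v : X → E} (hv : ∀ x, v x ∈ P)
    (hrep : ∀ x ∈ P, ∃ μ : X → ℝ, 0 ≤ μ ∧ ∑ a, μ a = 1 ∧ ∑ a, μ a • v a = x)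
    {c : E →ₗ[ℝ] ℝ} (hc : Function.Injective (c ∘ v)) {a : X} (ha : v a ∈ F)
    (hmin : ∀ x ∈ F, c (v a) ≤ c x) : v a ∈ F.extremePoints ℝ := by
  have key : ∀ x ∈ F, c x = c (v a) → x = v a := by
    intro x hx hcx
    obtain ⟨μ, h0, h1, rfl⟩ := hrep x (hF.1.subset hx)
    have hs : ∑ b, μ b * (c (v b) - c (v a)) = 0 := by
      simp only [mul_sub, sum_sub_distrib, ← sum_mul, h1, one_mul]
      rw [← hcx, map_sum]
      simp
    have hz := (sum_eq_zero_iff_of_nonneg fun b _ => by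
      by_cases h : μ b = 0
      · simp [h]
      · exact mul_nonneg (h0 b) (sub_nonneg.2 (hmin _ (hF.mem_of_sum_mem hv h0 h1 hx h)))).1 hs
    rw [← one_smul ℝ (v a), ← h1, sum_smul]
    refine sum_congr rfl fun b hb => ?_
    rcases mul_eq_zero.1 (hz b hb) with h | h
    · simp [h]
    · rw [hc (sub_eq_zero.1 h)]
  refine ⟨ha, fun x hx y hy hseg => ?_⟩
  obtain ⟨s, t, hs, ht, hst, he⟩ := hseg
  have h1 := hmin x hx
  have h2 := hmin y hy
  have h3 := congrArg c he
  simp only [map_add, map_smul, smul_eq_mul] at h3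
  refine key x hx (le_antisymm ?_ h1)
  have : c (v a) = s * c (v a) + t * c (v a) := by rw [← add_mul, hst, one_mul]
  nlinarith [mul_le_mul_of_nonneg_left h2 ht.le]

theorem exists_isPointedTriangulation [TopologicalSpace E] {X : Type*} [Fintype X] [DecidableEq X]
    [DecidableEq E] {P : Set E} (hP : Convex ℝ P) {v : X → E} (hv : ∀ x, v x ∈ P)
    {𝒞 : Set (Finset X)} (hdown : IsLowerSet 𝒞) (hsing : ∀ x, {x} ∈ 𝒞)
    (hu : HasUniqueWeights v 𝒞)
    (hcov : ∀ x ∈ P, ∃ μ : X → ℝ, 0 ≤ μ ∧ ({a | μ a ≠ 0} : Finset X) ∈ 𝒞 ∧ ∑ a, μ a = 1 ∧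
      ∑ a, μ a • v a = x)
    (c : E →ₗ[ℝ] ℝ) (hc : Function.Injective (c ∘ v))
    (hapex : ∀ F, IsFace P F → ∀ a, v a ∈ F → (∀ b, v b ∈ F → c (v a) ≤ c (v b)) →
      ∀ C ∈ 𝒞, (∀ b ∈ C, v b ∈ F) → insert a C ∈ 𝒞) :
    ∃ V K, IsPointedTriangulation P V K ∧ K.facets = {s | ∃ C ∈ 𝒞, C.Nonempty ∧
      (∀ D ∈ 𝒞, C ⊆ D → D = C) ∧ s = C.image v} := by
  have hvi : v.Injective := hc.of_comp
  have hrep : ∀ x ∈ P, ∃ μ : X → ℝ, 0 ≤ μ ∧ ∑ a, μ a = 1 ∧ ∑ a, μ a • v a = x := fun x hx => by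
    obtain ⟨μ, h0, -, h⟩ := hcov x hx
    exact ⟨μ, h0, h⟩
  have hmem : ∀ μ : X → ℝ, ∑ a, μ a = 1 → ∃ a, μ a ≠ 0 := fun μ h1 => by
    by_contra! h
    simp [h] at h1
  have hex : ∀ F, ∃ e : E, IsFace P F →
      ∃ a, e = v a ∧ v a ∈ F ∧ ∀ b, v b ∈ F → c (v a) ≤ c (v b) := by
    classical
    intro F
    by_cases hF : IsFace P F
    · obtain ⟨x, hx⟩ := hF.2
      obtain ⟨μ, h0, h1, rfl⟩ := hrep x (hF.1.subset hx)
      obtain ⟨a, ha⟩ := hmem μ h1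
      have hne : ({a | v a ∈ F} : Finset X).Nonempty :=
        ⟨a, by simpa using hF.mem_of_sum_mem hv h0 h1 hx ha⟩
      obtain ⟨a, ha, hm⟩ := exists_min_image _ (fun a => c (v a)) hne
      exact ⟨v a, fun _ => ⟨a, rfl, by simpa using ha, fun b hb => hm b (by simpa using hb)⟩⟩
    · exact ⟨0, fun h => (hF h).elim⟩
  choose V hV using hex
  have hVmin : ∀ F, IsFace P F → ∀ x ∈ F, c (V F) ≤ c x := by
    intro F hF x hx
    obtain ⟨a, ha, haF, hm⟩ := hV F hF
    obtain ⟨μ, h0, h1, rfl⟩ := hrep x (hF.1.subset hx)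
    rw [ha, ← one_mul (c (v a)), ← h1, sum_mul, map_sum]
    refine sum_le_sum fun b _ => ?_
    rw [map_smul, smul_eq_mul]
    by_cases h : μ b = 0
    · simp [h]
    · exact mul_le_mul_of_nonneg_left (hm b (hF.mem_of_sum_mem hv h0 h1 hx h)) (h0 b)
  have hVext : IsApexAssignment P V := by
    intro F hF
    obtain ⟨a, ha, haF, hm⟩ := hV F hF
    have := hVmin F hF
    rw [ha] at this ⊢
    exact mem_extremePoints_of_isMinOn hF hv hrep hc haF this
  have hext : ∀ F, IsFace P F → ∀ w ∈ F.extremePoints ℝ, ∃ a, v a = w := by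
    intro F hF w hw
    obtain ⟨μ, h0, h1, rfl⟩ := hrep w (hF.1.subset hw.1)
    exact hF.exists_eq_of_mem_extremePoints hP hv h0 h1 hw
  have hPF : P.Nonempty → IsFace P P := fun h => ⟨IsExposed.refl P, h⟩
  let K := complexOfWeights hvi hdown hu
  have hsimp : ∀ F, IsFace P F → ∀ x ∈ F, ∃ s ∈ K.faces,
      convexHull ℝ (s : Set E) ⊆ F ∧ x ∈ convexHull ℝ (s : Set E) := by
    intro F hF x hx
    obtain ⟨μ, h0, hμ, h1, rfl⟩ := hcov x (hF.1.subset hx)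
    obtain ⟨a, ha⟩ := hmem μ h1
    refine ⟨_, ⟨_, hμ, ⟨a, by simpa using ha⟩, rfl⟩, ?_, ?_⟩
    · refine convexHull_min (fun y hy => ?_) (hF.convex hP)
      obtain ⟨b, hb, rfl⟩ := mem_image.1 (mem_coe.1 hy)
      exact hF.mem_of_sum_mem hv h0 h1 hx (by simpa using hb)
    · exact (mem_convexHull_image_iff hvi _ _).2 ⟨μ, h0, by simp, h1, rfl⟩
  have hins : ∀ F, IsFace P F → ∀ a, V F = v a → ∀ C ∈ 𝒞, (∀ b ∈ C, v b ∈ F) →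
      insert a C ∈ 𝒞 := by
    intro F hF a ha C hC hCF
    obtain ⟨a', ha', haF, hm⟩ := hV F hF
    obtain rfl : a = a' := hvi (ha.symm.trans ha')
    exact hapex F hF a haF hm C hC hCF
  refine ⟨V, K, ⟨?_, ?_, hVext, hsimp, ?_, ?_, ?_, c, ?_, hVmin⟩, ?_⟩
  · refine (Set.finite_range fun C : Finset X => C.image v).subset ?_
    rintro _ ⟨C, -, -, rfl⟩
    exact ⟨C, rfl⟩
  · ext x
    rw [Geometry.SimplicialComplex.mem_space_iff]
    constructor
    · rintro ⟨_, ⟨C, hC, hne, rfl⟩, hx⟩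
      refine convexHull_min (fun y hy => ?_) hP hx
      obtain ⟨b, hb, rfl⟩ := mem_image.1 (mem_coe.1 hy)
      exact hv b
    · intro hx
      obtain ⟨s, hs, -, h⟩ := hsimp P (hPF ⟨x, hx⟩) x hx
      exact ⟨s, hs, h⟩
  · rintro F hF _ ⟨C, hC, hne, rfl⟩ hsub hmax
    obtain ⟨a, ha, haF, hm⟩ := hV F hF
    have hCF : ∀ b ∈ C, v b ∈ F := fun b hb =>
      hsub (subset_convexHull ℝ _ (mem_coe.2 (mem_image_of_mem v hb)))
    rw [ha, ← hmax ((insert a C).image v)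
      ⟨_, hins F hF a ha C hC hCF, insert_nonempty a C, rfl⟩ ?_
      (image_subset_image (subset_insert a C))]
    · exact mem_image_of_mem v (mem_insert_self a C)
    · refine convexHull_min (fun y hy => ?_) (hF.convex hP)
      obtain ⟨b, hb, rfl⟩ := mem_image.1 (mem_coe.1 hy)
      rcases mem_insert.1 hb with rfl | hb
      exacts [haF, hCF b hb]
  · intro F G hF hG h1 h2
    obtain ⟨a, ha, -⟩ := hV F hF
    obtain ⟨b, hb, -⟩ := hV G hG
    have h := le_antisymm (hVmin F hF _ h2.1) (hVmin G hG _ h1.2)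
    rw [ha, hb] at h ⊢
    rw [hc h]
  · intro F hF w hw hne
    obtain ⟨b, rfl⟩ := hext F hF w hw
    obtain ⟨a, ha, -⟩ := hV F hF
    refine ⟨_, ⟨_, hins F hF a ha {b} (hsing b) (by simpa using hw.1), insert_nonempty _ _, rfl⟩, ?_⟩
    rw [ha]
    simp [image_insert]
  · intro x hx y hy hxy
    obtain ⟨a, rfl⟩ := hext P (hPF ⟨x, hx.1⟩) x hx
    obtain ⟨b, rfl⟩ := hext P (hPF ⟨_, hx.1⟩) y hy
    rw [hc hxy]
  · ext s
    constructor
    · rintro ⟨⟨C, hC, hne, rfl⟩, hmax⟩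
      refine ⟨C, hC, hne, fun D hD hCD => ?_, rfl⟩
      exact (image_injective hvi (hmax ⟨D, hD, hne.mono hCD, rfl⟩ (image_subset_image hCD))).symm
    · rintro ⟨C, hC, hne, hmax, rfl⟩
      refine ⟨⟨C, hC, hne, rfl⟩, ?_⟩
      rintro _ ⟨D, hD, -, rfl⟩ hCD
      rw [hmax D hD ((image_subset_image_iff hvi).1 hCD)]

end Triangulations

section Chains

variable {ι : Type*} [Fintype ι] {κ : ι → Type*} [∀ j, Fintype (κ j)] [∀ j, LinearOrder (κ j)]

omit [Fintype ι] [∀ j, Fintype (κ j)] in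
theorem exists_forall_le_of_apply_le [Nonempty ι] {s : Finset (∀ j, κ j)}
    (hs : IsChain (· ≤ ·) (s : Set (∀ j, κ j))) (p : ∀ j, κ j) :
    ∃ j, ∀ q ∈ s, q j ≤ p j → q ≤ p := by
  classical
  by_cases h : ({q ∈ s | ¬ q ≤ p}).Nonempty
  · obtain ⟨r, hr⟩ := exists_minimal h
    obtain ⟨hrs, hrp⟩ := mem_filter.1 hr.1
    rw [Pi.le_def, not_forall] at hrp
    obtain ⟨j, hj⟩ := hrp
    refine ⟨j, fun q hq hqj => ?_⟩
    by_contra hqp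
    have hrq : r ≤ q := by
      rcases hs.total (mem_coe.2 hrs) (mem_coe.2 hq) with h1 | h1
      exacts [h1, hr.2 (mem_filter.2 ⟨hq, hqp⟩) h1]
    exact hj ((hrq j).trans hqj)
  · obtain ⟨j⟩ := ‹Nonempty ι›
    refine ⟨j, fun q hq _ => ?_⟩
    by_contra hqp
    exact h ⟨q, mem_filter.2 ⟨hq, hqp⟩⟩

open Classical in
theorem sum_Iic_le_of_marginals_eq [DecidableEq ι] [Nonempty ι] {μ ν : (∀ j, κ j) → ℝ} (hν0 : 0 ≤ ν)
    (hμ : IsChain (· ≤ ·) (({q | μ q ≠ 0} : Finset (∀ j, κ j)) : Set (∀ j, κ j)))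
    (h : ∀ j k, ∑ q with q j = k, μ q = ∑ q with q j = k, ν q) (p : ∀ j, κ j) :
    ∑ q with q ≤ p, ν q ≤ ∑ q with q ≤ p, μ q := by
  obtain ⟨j, hj⟩ := exists_forall_le_of_apply_le hμ p
  have hfib : ∀ ρ : (∀ j, κ j) → ℝ,
      ∑ q with q j ≤ p j, ρ q = ∑ k with k ≤ p j, ∑ q with q j = k, ρ q := fun ρ => by
    rw [← sum_fiberwise_of_maps_to (t := {k | k ≤ p j}) (g := fun q : ∀ j, κ j => q j) (by simp)]
    refine sum_congr rfl fun k hk => sum_congr ?_ fun _ _ => rfl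
    ext q
    simp only [mem_filter, mem_univ, true_and] at hk ⊢
    constructor
    · exact fun h => h.2
    · rintro rfl
      exact ⟨hk, rfl⟩
  calc ∑ q with q ≤ p, ν q ≤ ∑ q with q j ≤ p j, ν q :=
        sum_le_sum_of_subset_of_nonneg (fun q hq => by simpa using (mem_filter.1 hq).2 j)
          fun q _ _ => hν0 q
    _ = ∑ q with q j ≤ p j, μ q := by simp only [hfib, h]
    _ = ∑ q with q ≤ p, μ q := by
        symm
        refine sum_subset (fun q hq => by simpa using (mem_filter.1 hq).2 j) fun q hq hq' => ?_
        by_contra hne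
        exact hq' (by simpa using hj q (by simpa using hne) (mem_filter.1 hq).2)

/-- Nonnegative weights supported on a chain of a product are determined by their marginals. -/
theorem eq_of_marginals_eq [DecidableEq ι] [Nonempty ι] {μ ν : (∀ j, κ j) → ℝ} (hμ0 : 0 ≤ μ)
    (hν0 : 0 ≤ ν)
    (hμ : IsChain (· ≤ ·) (({q | μ q ≠ 0} : Finset (∀ j, κ j)) : Set (∀ j, κ j)))
    (hν : IsChain (· ≤ ·) (({q | ν q ≠ 0} : Finset (∀ j, κ j)) : Set (∀ j, κ j)))
    (h : ∀ j k, ∑ q with q j = k, μ q = ∑ q with q j = k, ν q) : μ = ν := by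
  classical
  have hG : ∀ p, ∑ q with q ≤ p, μ q = ∑ q with q ≤ p, ν q := fun p =>
    le_antisymm (sum_Iic_le_of_marginals_eq hμ0 hν (fun j k => (h j k).symm) p)
      (sum_Iic_le_of_marginals_eq hν0 hμ h p)
  funext p
  induction p using WellFoundedLT.induction with
  | ind p ih =>
    have := hG p
    have hp : univ.filter (fun q => q ≤ p) = insert p (univ.filter fun q => q < p) := by
      ext q
      simp only [mem_filter, mem_univ, true_and, mem_insert]
      exact le_iff_eq_or_lt
    rw [hp, sum_insert (by simp), sum_insert (by simp),
      sum_congr rfl fun q hq => ih q (mem_filter.1 hq).2] at this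
    exact add_right_cancel this

/-- Nonnegative functions with equal sums are the marginals of weights supported on a chain. -/
theorem exists_chain_weights [DecidableEq ι] (c : ∀ j, κ j → ℝ) (hc : ∀ j, 0 ≤ c j) (m : ℝ)
    (hm : ∀ j, ∑ k, c j k = m) (hm0 : 0 ≤ m) : ∃ μ : (∀ j, κ j) → ℝ, 0 ≤ μ ∧
      IsChain (· ≤ ·) (({q | μ q ≠ 0} : Finset (∀ j, κ j)) : Set (∀ j, κ j)) ∧
      ∀ j k, ∑ q with q j = k, μ q = c j k := by
  induction hn : ∑ j, #{k | c j k ≠ 0} using Nat.strong_induction_on generalizing c m with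
  | h n ih =>
  rcases hm0.eq_or_lt with rfl | hm0
  · refine ⟨0, le_rfl, by simp, fun j k => ?_⟩
    rw [(sum_eq_zero_iff_of_nonneg fun k _ => hc j k).1 (hm j) k (mem_univ k)]
    simp
  rcases isEmpty_or_nonempty ι with hι | hι
  · exact ⟨0, le_rfl, by simp, fun j => isEmptyElim j⟩
  have hne : ∀ j, ({k | c j k ≠ 0} : Finset (κ j)).Nonempty := fun j => by
    by_contra h
    rw [not_nonempty_iff_eq_empty, filter_eq_empty_iff] at h
    rw [← hm j, sum_eq_zero fun k hk => by simpa using h hk] at hm0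
    exact hm0.false
  let p : ∀ j, κ j := fun j => ({k | c j k ≠ 0} : Finset (κ j)).min' (hne j)
  have hp : ∀ j, 0 < c j (p j) := fun j =>
    (hc j _).lt_of_ne' (by simpa using min'_mem _ (hne j))
  have hpmin : ∀ j k, c j k ≠ 0 → p j ≤ k := fun j k hk => min'_le _ _ (by simpa using hk)
  obtain ⟨i, -, hi⟩ := exists_min_image univ (fun j => c j (p j)) univ_nonempty
  set t := c i (p i) with ht
  let c' : ∀ j, κ j → ℝ := fun j k => c j k - if k = p j then t else 0
  have hc' : ∀ j, 0 ≤ c' j := fun j k => by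
    simp only [c', Pi.zero_apply]
    split_ifs with h
    · rw [h]
      exact sub_nonneg.2 (hi j (mem_univ j))
    · simpa using hc j k
  have hsup : ∀ j k, c' j k ≠ 0 → c j k ≠ 0 := fun j k h h0 => by
    have hk : k ≠ p j := by
      rintro rfl
      exact (hp j).ne' h0
    simp [c', hk, h0] at h
  have hm' : ∀ j, ∑ k, c' j k = m - t := fun j => by simp [c', hm]
  obtain ⟨μ, h0, hch, hmarg⟩ := ih (∑ j, #{k | c' j k ≠ 0}) (by
      rw [← hn]
      refine sum_lt_sum (fun j _ => card_le_card fun k hk => ?_) ⟨i, mem_univ i, card_lt_card ?_⟩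
      · simpa using hsup j k (by simpa using hk)
      · refine (ssubset_iff_of_subset fun k hk => by simpa using hsup i k (by simpa using hk)).2
          ⟨p i, by simpa using (hp i).ne', by simp [c', ht]⟩)
    c' hc' (m - t) hm' ((hm' i) ▸ sum_nonneg fun k _ => hc' i k) rfl
  have hge : ∀ q, μ q ≠ 0 → p ≤ q := fun q hq j => by
    refine hpmin j _ (hsup j _ ?_)
    rw [← hmarg]
    exact (lt_of_lt_of_le ((h0 q).lt_of_ne' hq)
      (single_le_sum (f := μ) (fun q _ => h0 q) (by simp))).ne'
  refine ⟨fun q => μ q + if q = p then t else 0, fun q => ?_, ?_, fun j k => ?_⟩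
  · have := h0 q
    have := (hp i).le
    simp only [Pi.zero_apply] at *
    positivity
  · have : ∀ q, μ q + (if q = p then t else 0) ≠ 0 → q = p ∨ μ q ≠ 0 := fun q hq => by
      by_cases h : q = p
      · exact .inl h
      · exact .inr (by simpa [h] using hq)
    refine IsChain.mono (fun q hq => ?_) (hch.insert (a := p) fun q hq _ => .inl (hge q ?_))
    · simpa using this q (by simpa using hq)
    · simpa using hq
  · rw [sum_add_distrib, hmarg]
    simp only [c']
    rw [← sum_filter, filter_filter]
    by_cases h : k = p j
    · rw [show ({q | q j = k ∧ q = p} : Finset (∀ j, κ j)) = {p} by ext q; simp +contextual [h]]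
      simp [h]
    · rw [show ({q | q j = k ∧ q = p} : Finset (∀ j, κ j)) = ∅ by
        ext q
        simp only [mem_filter, mem_univ, true_and, notMem_empty, iff_false, not_and]
        rintro rfl rfl
        exact h rfl]
      simp [h]

end Chains

section Words

variable {l N : ℕ} {d : Fin l → ℕ}

/-- The number of occurrences of `j` among the first `i` letters of `w`. -/
def prefixCount (w : Fin N → Fin l) (i : ℕ) (j : Fin l) : ℕ :=
  #{k : Fin N | (k : ℕ) < i ∧ w k = j}

theorem prefixCount_mono (w : Fin N → Fin l) (j : Fin l) : Monotone fun i => prefixCount w i j :=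
  fun i i' h => card_le_card fun k hk => by
    simp only [mem_filter, mem_univ, true_and] at hk ⊢
    exact ⟨hk.1.trans_le h, hk.2⟩

theorem sum_prefixCount (w : Fin N → Fin l) {i : ℕ} (hi : i ≤ N) : ∑ j, prefixCount w i j = i := by
  simp only [prefixCount, ← filter_filter]
  rw [← card_eq_sum_card_fiberwise (fun _ _ => mem_coe.2 (mem_univ _))]
  have := Fin.card_filter_val_lt (n := N) (m := i)
  simpa [hi] using this

theorem prefixCount_le {w : Fin N → Fin l} (hw : ∀ j, #{k | w k = j} = d j) (i : ℕ) (j : Fin l) :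
    prefixCount w i j ≤ d j := by
  rw [← hw j]
  exact card_le_card fun k hk => by
    simp only [mem_filter, mem_univ, true_and] at hk ⊢
    exact hk.2

/-- The lattice path with steps given by the letters of `w`. -/
def pathPoint {w : Fin N → Fin l} (hw : ∀ j, #{k | w k = j} = d j) (i : ℕ) (j : Fin l) :
    Fin (d j + 1) :=
  ⟨prefixCount w i j, Nat.lt_succ_of_le (prefixCount_le hw i j)⟩

/-- The set of lattice points on the path of `w`. -/
def pathChain {w : Fin N → Fin l} (hw : ∀ j, #{k | w k = j} = d j) :
    Finset (∀ j, Fin (d j + 1)) :=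
  univ.image fun i : Fin (N + 1) => pathPoint hw i

theorem isChain_pathChain {w : Fin N → Fin l} (hw : ∀ j, #{k | w k = j} = d j) :
    IsChain (· ≤ ·) (pathChain hw : Set (∀ j, Fin (d j + 1))) := by
  have hmono : Monotone (pathPoint hw) := fun i i' h j => prefixCount_mono w j h
  rw [pathChain, coe_image]
  rintro _ ⟨i, -, rfl⟩ _ ⟨i', -, rfl⟩ -
  exact (le_total i i').imp (fun h => hmono h) fun h => hmono h

theorem eq_pathChain_of_subset (hN : ∑ j, d j = N) {w : Fin N → Fin l}
    (hw : ∀ j, #{k | w k = j} = d j) {D : Finset (∀ j, Fin (d j + 1))}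
    (hD : IsChain (· ≤ ·) (D : Set (∀ j, Fin (d j + 1)))) (h : pathChain hw ⊆ D) :
    D = pathChain hw := by
  refine Subset.antisymm (fun q hq => ?_) h
  have hqN : ∑ j, (q j : ℕ) ≤ N := by
    rw [← hN]
    exact sum_le_sum fun j _ => Nat.le_of_lt_succ (q j).2
  have hmem : pathPoint hw (∑ j, (q j : ℕ)) ∈ pathChain hw :=
    mem_image.2 ⟨⟨_, Nat.lt_succ_of_le hqN⟩, mem_univ _, rfl⟩
  have hsum : ∑ j, (pathPoint hw (∑ j, (q j : ℕ)) j : ℕ) = ∑ j, (q j : ℕ) :=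
    sum_prefixCount w hqN
  have key : ∀ a b : ∀ j, Fin (d j + 1), a ≤ b → ∑ j, (a j : ℕ) = ∑ j, (b j : ℕ) → a = b := by
    intro a b hab he
    rw [sum_eq_sum_iff_of_le fun j _ => hab j] at he
    exact funext fun j => Fin.ext (he j (mem_univ j))
  rcases hD.total (mem_coe.2 hq) (mem_coe.2 (h hmem)) with h1 | h1
  · rwa [key _ _ h1 hsum.symm]
  · rwa [← key _ _ h1 hsum]

theorem exists_subset_pathChain (hN : ∑ j, d j = N) (hN1 : 1 ≤ N)
    {C : Finset (∀ j, Fin (d j + 1))} (hC : IsChain (· ≤ ·) (C : Set (∀ j, Fin (d j + 1)))) :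
    ∃ (w : Fin N → Fin l) (hw : ∀ j, #{k | w k = j} = d j), C ⊆ pathChain hw := by
  have hl : Nonempty (Fin l) := by
    by_contra h
    rw [not_nonempty_iff] at h
    simp at hN
    omega
  have hst : ∀ p : Fin l → ℕ, ∃ j, (∃ j, p j < d j) → p j < d j ∧
      ∀ q ∈ C, (∀ j, p j ≤ q j) → (∃ j, p j < q j) → p j < q j := by
    classical
    intro p
    by_cases h : ∃ j, p j < d j
    · by_cases hne : ({q ∈ C | (∀ j, p j ≤ q j) ∧ ∃ j, p j < q j}).Nonempty
      · obtain ⟨r, hr⟩ := exists_minimal hne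
        obtain ⟨hrC, -, j, hj⟩ := mem_filter.1 hr.1
        refine ⟨j, fun _ => ⟨hj.trans_le (Nat.le_of_lt_succ (r j).2), fun q hq h1 h2 => ?_⟩⟩
        have hrq : r ≤ q := by
          rcases hC.total (mem_coe.2 hrC) (mem_coe.2 hq) with h3 | h3
          exacts [h3, hr.2 (mem_filter.2 ⟨hq, h1, h2⟩) h3]
        exact hj.trans_le (hrq j)
      · obtain ⟨j, hj⟩ := h
        refine ⟨j, fun _ => ⟨hj, fun q hq h1 h2 => ?_⟩⟩
        exact (hne ⟨q, mem_filter.2 ⟨hq, h1, h2⟩⟩).elim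
    · exact ⟨hl.some, fun h' => (h h').elim⟩
  choose st hst using hst
  let path : ℕ → Fin l → ℕ := fun n =>
    Nat.rec (fun _ => 0) (fun _ p => Function.update p (st p) (p (st p) + 1)) n
  have hsucc : ∀ i, path (i + 1) =
      Function.update (path i) (st (path i)) (path i (st (path i)) + 1) := fun i => rfl
  have hsum : ∀ i, ∑ j, path i j = i := fun i => by
    induction i with
    | zero => simp [path]
    | succ i ih =>
      rw [hsucc, sum_update_of_mem (mem_univ _)]
      rw [← add_sum_erase _ _ (mem_univ (st (path i)))] at ih
      rw [← erase_eq]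
      omega
  have hlt : ∀ i < N, (∀ j, path i j ≤ d j) → ∃ j, path i j < d j := fun i hi h => by
    by_contra! h'
    have : ∑ j, path i j = ∑ j, d j := sum_congr rfl fun j _ => (h j).antisymm (h' j)
    rw [hsum, hN] at this
    omega
  have hle : ∀ i ≤ N, ∀ j, path i j ≤ d j := fun i => by
    induction i with
    | zero => simp [path]
    | succ i ih =>
      intro hi j
      have h1 := ih (by omega)
      have h2 := (hst _ (hlt i hi h1)).1
      rw [hsucc, Function.update_apply]
      split_ifs with h
      · rwa [h]
      · exact h1 j
  have hcov : ∀ q ∈ C, ∀ i ≤ N, (∃ i' ≤ i, ∀ j, (q j : ℕ) = path i' j) ∨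
      ∀ j, path i j ≤ q j := fun q hq i => by
    induction i with
    | zero => simp [path]
    | succ i ih =>
      intro hi
      rcases ih (by omega) with ⟨i', hi', h⟩ | h
      · exact .inl ⟨i', by omega, h⟩
      · by_cases hex : ∃ j, path i j < q j
        · have h2 := (hst _ (hlt i hi (hle i (by omega)))).2 q hq h hex
          refine .inr fun j => ?_
          rw [hsucc, Function.update_apply]
          split_ifs with hj
          · rwa [hj]
          · exact h j
        · push Not at hex
          exact .inl ⟨i, by omega, fun j => (hex j).antisymm (h j)⟩
  have hcount : ∀ i ≤ N, ∀ j, prefixCount (fun k : Fin N => st (path k)) i j = path i j :=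
      fun i => by
    induction i with
    | zero => simp [path, prefixCount]
    | succ i ih =>
      intro hi j
      rw [hsucc, Function.update_apply]
      have h0 := ih (by omega) j
      split_ifs with hj
      · rw [← hj, ← h0, prefixCount, prefixCount, ← card_insert_of_notMem (a := ⟨i, hi⟩) (by simp)]
        congr 1
        ext k
        simp only [mem_filter, mem_univ, true_and, mem_insert, Fin.ext_iff]
        constructor
        · rintro ⟨h1, h2⟩
          rcases Nat.lt_succ_iff_lt_or_eq.1 h1 with h1 | h1
          exacts [.inr ⟨h1, h2⟩, .inl h1]
        · rintro (h1 | ⟨h1, h2⟩)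
          · exact ⟨by omega, by rw [h1, hj]⟩
          · exact ⟨by omega, h2⟩
      · rw [← h0, prefixCount, prefixCount]
        congr 1
        ext k
        simp only [mem_filter, mem_univ, true_and]
        constructor
        · rintro ⟨h1, h2⟩
          rcases Nat.lt_succ_iff_lt_or_eq.1 h1 with h1 | h1
          · exact ⟨h1, h2⟩
          · rw [h1] at h2
            exact (hj h2.symm).elim
        · exact fun h1 => ⟨by omega, h1.2⟩
  have htop : ∀ j, path N j = d j := by
    have h1 : ∑ j, path N j = ∑ j, d j := by rw [hsum, hN]
    rw [sum_eq_sum_iff_of_le fun j _ => hle N le_rfl j] at h1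
    exact fun j => h1 j (mem_univ j)
  have hw : ∀ j, #{k : Fin N | st (path k) = j} = d j := fun j => by
    rw [← htop, ← hcount N le_rfl, prefixCount]
    simp
  refine ⟨_, hw, fun q hq => ?_⟩
  have hfin : ∃ i' ≤ N, ∀ j, (q j : ℕ) = path i' j := by
    rcases hcov q hq N le_rfl with h | h
    · exact h
    · exact ⟨N, le_rfl, fun j =>
        le_antisymm ((Nat.le_of_lt_succ (q j).2).trans (htop j).ge) (h j)⟩
  obtain ⟨i, hi, h⟩ := hfin
  refine mem_image.2 ⟨⟨i, Nat.lt_succ_of_le hi⟩, mem_univ _, funext fun j => Fin.ext ?_⟩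
  rw [h, ← hcount i hi]
  rfl

end Words

/-- A linear parametrization of a polytope in `E` by a product of standard simplices, with
barycentric coordinates given by affine functions `x ↦ coord j k x + off j k` on `E`. -/
structure SimplexProductParam {ι : Type*} (κ : ι → Type*) [∀ j, Fintype (κ j)] (E : Type*)
    [AddCommGroup E] [Module ℝ E] [TopologicalSpace E] where
  toLin : (∀ j, κ j → ℝ) →ₗ[ℝ] E
  coord : ∀ j, κ j → StrongDual ℝ E
  off : ∀ j, κ j → ℝ
  coord_toLin : ∀ c, (∀ j, c j ∈ stdSimplex ℝ (κ j)) → ∀ j k,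
    coord j k (toLin c) + off j k = c j k

namespace SimplexProductParam

section Basic

variable {ι : Type*} {κ : ι → Type*} [∀ j, Fintype (κ j)] {E : Type*}
  [AddCommGroup E] [Module ℝ E] [TopologicalSpace E] (M : SimplexProductParam κ E)

/-- The face with vertices in `S`. -/
def face (S : ∀ j, Finset (κ j)) : Set E :=
  M.toLin '' {c | ∀ j, c j ∈ stdSimplex ℝ (κ j) ∧ ∀ k ∉ S j, c j k = 0}

/-- The parametrized polytope. -/
def polytope : Set E := M.toLin '' Set.univ.pi fun j => stdSimplex ℝ (κ j)

theorem face_univ : M.face (fun _ => univ) = M.polytope := by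
  simp [face, polytope, Set.pi]

theorem convex_polytope : Convex ℝ M.polytope :=
  (convex_pi fun j _ => convex_stdSimplex ℝ (κ j)).linear_image M.toLin

/-- The vertex with index `k j` in the factor `j`. -/
noncomputable def vertex [∀ j, LinearOrder (κ j)] (k : ∀ j, κ j) : E :=
  M.toLin fun j => Pi.single (k j) 1

variable [∀ j, LinearOrder (κ j)]

theorem vertex_mem_polytope (q : ∀ j, κ j) : M.vertex q ∈ M.polytope :=
  ⟨_, fun j _ => single_mem_stdSimplex ℝ (q j), rfl⟩

theorem coord_vertex (q : ∀ j, κ j) (j : ι) (k : κ j) :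
    M.coord j k (M.vertex q) = (if q j = k then 1 else 0) - M.off j k := by
  rw [eq_sub_iff_add_eq, vertex, M.coord_toLin _ fun j => single_mem_stdSimplex ℝ (q j)]
  simp [Pi.single_apply, eq_comm]

variable [Fintype ι] [DecidableEq ι] [Nonempty ι]

theorem hasUniqueWeights_chains : HasUniqueWeights M.vertex
    {C : Finset (∀ j, κ j) | IsChain (· ≤ ·) (C : Set (∀ j, κ j))} := by
  intro μ ν hμ0 hν0 hμ hν h1 h
  refine eq_of_marginals_eq hμ0 hν0 hμ hν fun j k => ?_
  have key : ∀ ρ : (∀ j, κ j) → ℝ, ∑ q with q j = k, ρ q =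
      M.coord j k (∑ q, ρ q • M.vertex q) + M.off j k * ∑ q, ρ q := fun ρ => by
    simp [coord_vertex, mul_sub, mul_sum, mul_comm, sum_filter]
  rw [key, key, h, h1]

theorem exists_chain_weights_of_mem {x : E} (hx : x ∈ M.polytope) :
    ∃ μ : (∀ j, κ j) → ℝ, 0 ≤ μ ∧ IsChain (· ≤ ·)
      (({q | μ q ≠ 0} : Finset (∀ j, κ j)) : Set (∀ j, κ j)) ∧
      ∑ q, μ q = 1 ∧ ∑ q, μ q • M.vertex q = x := by
  obtain ⟨c, hc, rfl⟩ := hx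
  obtain ⟨μ, h0, hch, hm⟩ := exists_chain_weights c (fun j => (hc j trivial).1) 1
    (fun j => (hc j trivial).2) zero_le_one
  obtain ⟨i⟩ := ‹Nonempty ι›
  refine ⟨μ, h0, hch, ?_, ?_⟩
  · rw [← (hc i trivial).2, ← sum_fiberwise univ fun q : ∀ j, κ j => q i]
    exact sum_congr rfl fun k _ => hm _ k
  · simp only [vertex, ← map_smul, ← map_sum]
    congr 1
    funext j k
    simp [Finset.sum_apply, ← hm j k, Pi.single_apply, sum_filter, eq_comm]

end Basic

section Triangulation

variable {l : ℕ} {d : Fin l → ℕ} {E : Type*} [AddCommGroup E] [Module ℝ E] [TopologicalSpace E]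
  (M : SimplexProductParam (fun j => Fin (d j + 1)) E)

theorem vertex_add_vertex (a b : ∀ j, Fin (d j + 1)) :
    M.vertex (a ⊓ b) + M.vertex (a ⊔ b) = M.vertex a + M.vertex b := by
  simp only [vertex, ← map_add]
  congr 1
  funext j
  rcases le_total (a j) (b j) with h | h
  · simp [h]
  · simp [h, add_comm]

/-- A linear form separating the vertices and increasing in the indices of the vertices. -/
noncomputable def genericForm : E →ₗ[ℝ] ℝ :=
  ∑ j, ∑ k : Fin (d j + 1), (2 ^ Nat.pair k j : ℝ) • (M.coord j k : E →ₗ[ℝ] ℝ)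

theorem genericForm_vertex (q : ∀ j, Fin (d j + 1)) : M.genericForm (M.vertex q) =
    ∑ j, (2 ^ Nat.pair (q j) j : ℝ) - ∑ j, ∑ k : Fin (d j + 1), 2 ^ Nat.pair k j * M.off j k := by
  simp [genericForm, coord_vertex, mul_sub, LinearMap.sum_apply, sum_sub_distrib]

theorem genericForm_injective : Function.Injective (M.genericForm ∘ M.vertex) := by
  intro q q' h
  simp only [Function.comp_apply, genericForm_vertex, sub_left_inj] at h
  have hinj : ∀ q : ∀ j, Fin (d j + 1),
      Function.Injective fun j : Fin l => Nat.pair (q j) j := fun q j j' h =>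
    Fin.ext (Nat.pair_eq_pair.1 h).2
  have hs : ∀ q : ∀ j, Fin (d j + 1), ∑ j, 2 ^ Nat.pair (q j) j =
      ∑ i ∈ univ.image fun j : Fin l => Nat.pair (q j) j, 2 ^ i := fun q => by
    rw [sum_image (hinj q).injOn]
  have h' : ∑ j, 2 ^ Nat.pair (q j) j = ∑ j, 2 ^ Nat.pair (q' j) j := by exact_mod_cast h
  rw [hs, hs] at h'
  have := geomSum_injective le_rfl h'
  funext j
  have hj : Nat.pair (q j) j ∈ univ.image fun j : Fin l => Nat.pair (q j) j :=
    mem_image_of_mem (fun j : Fin l => Nat.pair (q j) j) (mem_univ j)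
  rw [this] at hj
  obtain ⟨j', -, he⟩ := mem_image.1 hj
  obtain ⟨h1, h2⟩ := Nat.pair_eq_pair.1 he
  obtain rfl : j' = j := Fin.ext h2
  exact Fin.ext h1.symm

theorem genericForm_mono {q q' : ∀ j, Fin (d j + 1)} (h : q ≤ q') :
    M.genericForm (M.vertex q) ≤ M.genericForm (M.vertex q') := by
  rw [genericForm_vertex, genericForm_vertex]
  refine sub_le_sub_right (sum_le_sum fun j _ => ?_) _
  refine pow_le_pow_right₀ one_le_two ?_
  rcases (h j).eq_or_lt with h | h
  · rw [h]
  · exact (Nat.pair_lt_pair_left _ h).le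

/-- The staircase triangulation of a product of simplices is a pointed triangulation. -/
theorem exists_pointed_staircase_triangulation {N : ℕ} (hN : ∑ j, d j = N) (hN1 : 1 ≤ N) :
    ∃ V K, IsPointedTriangulation M.polytope V K ∧ ∀ s, s ∈ K.facets ↔
      ∃ w : Fin N → Fin l, ∃ hw : ∀ j, #{k | w k = j} = d j,
        (s : Set E) = Set.range fun i : Fin (N + 1) => M.vertex (pathPoint hw i) := by
  classical
  have hl : 0 < l := by
    rcases Nat.eq_zero_or_pos l with rfl | h
    · simp at hN
      omega
    · exact h
  have : Nonempty (Fin l) := ⟨⟨0, hl⟩⟩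
  obtain ⟨V, K, hK, hfac⟩ := exists_isPointedTriangulation M.convex_polytope
    M.vertex_mem_polytope
    (𝒞 := {C : Finset (∀ j, Fin (d j + 1)) | IsChain (· ≤ ·) (C : Set (∀ j, Fin (d j + 1)))})
    (fun C D h hC => IsChain.mono (coe_subset.2 h) hC) (fun x => by simp)
    (M.hasUniqueWeights_chains)
    (fun x hx => M.exists_chain_weights_of_mem hx) M.genericForm M.genericForm_injective (by
      intro F hF a ha hmin C hC hCF
      have hle : ∀ b, M.vertex b ∈ F → a ≤ b := fun b hb => by
        have hm := hF.mem_of_midpoint_mem (M.vertex_mem_polytope (a ⊓ b))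
          (M.vertex_mem_polytope (a ⊔ b)) ha hb (M.vertex_add_vertex a b)
        have := M.genericForm_injective
          (le_antisymm (M.genericForm_mono inf_le_left) (hmin _ hm))
        exact inf_eq_left.1 this
      rw [Set.mem_ofPred_eq, coe_insert]
      exact IsChain.insert hC fun b hb _ => .inl (hle b (hCF b hb)))
  have himg : ∀ (w : Fin N → Fin l) (hw : ∀ j, #{k | w k = j} = d j),
      (((pathChain hw).image M.vertex : Finset E) : Set E) =
        Set.range fun i : Fin (N + 1) => M.vertex (pathPoint hw i) := fun w hw => by
    rw [pathChain, image_image, coe_image, coe_univ, Set.image_univ]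
    rfl
  refine ⟨V, K, hK, fun s => ?_⟩
  rw [hfac]
  constructor
  · rintro ⟨C, hC, hne, hmax, rfl⟩
    obtain ⟨w, hw, hsub⟩ := exists_subset_pathChain hN hN1 hC
    refine ⟨w, hw, ?_⟩
    rw [← hmax _ (isChain_pathChain hw) hsub, himg]
  · rintro ⟨w, hw, hs⟩
    refine ⟨pathChain hw, isChain_pathChain hw, univ_nonempty.image _,
      fun D hD h => eq_pathChain_of_subset hN hw hD h, ?_⟩
    rw [← coe_inj, hs, himg]

end Triangulation

end SimplexProductParam

section Binomial

theorem sum_powerset_choose_card {α : Type*} (s : Finset α) (m : ℕ) :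
    ∑ t ∈ s.powerset, m.choose #t = (m + #s).choose #s := by
  rw [sum_powerset_apply_card, Nat.add_choose_eq, Nat.sum_antidiagonal_eq_sum_range_succ_mk]
  refine sum_congr rfl fun i hi => ?_
  rw [smul_eq_mul, mul_comm, Nat.choose_symm (Nat.lt_succ_iff.1 (mem_range.1 hi))]

theorem sum_nonempty_powerset_choose {α : Type*} [DecidableEq α] {s : Finset α} (hs : s.Nonempty)
    (m : ℕ) : ∑ t ∈ s.powerset with t.Nonempty, m.choose (#t - 1) =
      (m + 1 + (#s - 1)).choose (#s - 1) := by
  obtain ⟨k, hk⟩ : ∃ k, #s = k + 1 := ⟨#s - 1, by have := hs.card_pos; omega⟩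
  have h1 : ∑ t ∈ s.powerset with t.Nonempty, m.choose (#t - 1) =
      ∑ t ∈ s.powerset, (fun i => if i = 0 then 0 else m.choose (i - 1)) #t := by
    rw [sum_filter]
    refine sum_congr rfl fun t _ => ?_
    rcases t.eq_empty_or_nonempty with rfl | h
    · simp
    · simp [h, h.ne_empty]
  have h2 : (m + (k + 1)).choose k = ∑ i ∈ range (k + 1), m.choose i * (k + 1).choose (k - i) := by
    rw [Nat.add_choose_eq, Nat.sum_antidiagonal_eq_sum_range_succ_mk]
  rw [h1, sum_powerset_apply_card (fun i => (if i = 0 then 0 else m.choose (i - 1) : ℕ)), hk,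
    sum_range_succ', Nat.add_sub_cancel, show m + 1 + k = m + (k + 1) by ring, h2]
  simp only [smul_eq_mul, if_true, mul_zero, add_zero]
  refine sum_congr rfl fun i hi => ?_
  have hi := mem_range.1 hi
  rw [if_neg (by omega), mul_comm, ← Nat.choose_symm (by omega : k - i ≤ k + 1),
    show k + 1 - (k - i) = i + 1 by omega]
  simp

theorem sum_powerset_mem_choose {α : Type*} [DecidableEq α] {s : Finset α} {q : α} (hq : q ∈ s)
    (m : ℕ) : ∑ t ∈ s.powerset with t.Nonempty ∧ q ∈ t, m.choose (#t - 1) =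
      (m + (#s - 1)).choose (#s - 1) := by
  rw [← card_erase_of_mem hq, ← sum_powerset_choose_card]
  refine sum_nbij' (fun t => t.erase q) (fun t => insert q t) ?_ ?_ ?_ ?_ ?_
  · intro t ht
    simp only [mem_filter, mem_powerset] at ht ⊢
    exact erase_subset_erase q ht.1
  · intro t ht
    simp only [mem_filter, mem_powerset] at ht ⊢
    exact ⟨insert_subset hq (ht.trans (erase_subset q s)), insert_nonempty q t, mem_insert_self q t⟩
  · intro t ht
    exact insert_erase (mem_filter.1 ht).2.2
  · intro t ht
    exact erase_insert fun h => notMem_erase q s (mem_powerset.1 ht h)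
  · intro t ht
    rw [card_erase_of_mem (mem_filter.1 ht).2.2]

end Binomial

section ProperFaces

variable {E : Type*} [AddCommGroup E] [Module ℝ E]

theorem finsum_isProperFace_eq [TopologicalSpace E] {α : Type*} {P : Set E} {A : Finset α} {φ : α → Set E}
    (hinj : Set.InjOn φ A) (h : ∀ F, IsProperFace P F ↔ ∃ a ∈ A, F = φ a) (g : Set E → ℤ) :
    ∑ᶠ F : {F : Set E // IsProperFace P F}, g F.1 = ∑ a ∈ A, g (φ a) := by
  let e : A → {F : Set E // IsProperFace P F} := fun a => ⟨φ a, (h _).2 ⟨a, a.2, rfl⟩⟩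
  have he : Function.Bijective e := by
    constructor
    · intro a b hab
      exact Subtype.ext (hinj a.2 b.2 (congrArg Subtype.val hab))
    · rintro ⟨F, hF⟩
      obtain ⟨a, ha, rfl⟩ := (h F).1 hF
      exact ⟨⟨a, ha⟩, rfl⟩
  rw [← finsum_comp e he, finsum_eq_sum_of_fintype]
  exact sum_coe_sort A fun a => g (φ a)

theorem polytopeDim_eq_zero_iff [FiniteDimensional ℝ E] {P : Set E} :
    polytopeDim P = 0 ↔ P.Subsingleton := by
  rw [polytopeDim, Submodule.finrank_eq_zero, vectorSpan_eq_bot_iff_subsingleton]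

end ProperFaces

namespace SimplexProductParam

variable {ι : Type*} [Fintype ι] [DecidableEq ι] {κ : ι → Type*} [∀ j, Fintype (κ j)]
  [∀ j, LinearOrder (κ j)] {E : Type*} [AddCommGroup E] [Module ℝ E] [TopologicalSpace E]
  (M : SimplexProductParam κ E)

omit [Fintype ι] [DecidableEq ι] in
theorem vertex_mem_face_iff {q : ∀ j, κ j} {S : ∀ j, Finset (κ j)} :
    M.vertex q ∈ M.face S ↔ ∀ j, q j ∈ S j := by
  constructor
  · rintro ⟨c, hc, he⟩ j
    by_contra hj
    have h1 := M.coord_toLin c (fun j => (hc j).1) j (q j)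
    rw [he, M.coord_vertex, (hc j).2 _ hj] at h1
    simp at h1
  · intro h
    refine ⟨_, fun j => ⟨single_mem_stdSimplex ℝ (q j), fun k hk => ?_⟩, rfl⟩
    rw [Pi.single_apply, if_neg]
    rintro rfl
    exact hk (h j)

omit [Fintype ι] in
theorem subset_of_face_subset {S T : ∀ j, Finset (κ j)} (hS : ∀ j, (S j).Nonempty)
    (h : M.face S ⊆ M.face T) (j : ι) : S j ⊆ T j := by
  intro k hk
  choose s hs using hS
  have := M.vertex_mem_face_iff.1
    (h ((M.vertex_mem_face_iff (q := Function.update s j k)).2 fun i => ?_)) j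
  · simpa using this
  · rcases eq_or_ne i j with rfl | hi
    · simpa using hk
    · simpa [hi] using hs i

omit [DecidableEq ι] in
/-- The face of a product of simplices on which a linear form is maximal. -/
theorem maximizers_eq_face {S T : ∀ j, Finset (κ j)} (hTS : ∀ j, T j ⊆ S j)
    (hT : ∀ j, (T j).Nonempty) {l : E → ℝ} {C : ℝ} {g : ∀ j, κ j → ℝ}
    (hl : ∀ c, (∀ j, c j ∈ stdSimplex ℝ (κ j)) → l (M.toLin c) = C + ∑ j, ∑ k, c j k * g j k)
    {m : ι → ℝ} (hm : ∀ j, ∀ k ∈ T j, g j k = m j) (hlt : ∀ j, ∀ k ∈ S j, k ∉ T j → g j k < m j) :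
    {x ∈ M.face S | ∀ y ∈ M.face S, l y ≤ l x} = M.face T := by
  have hle : ∀ j, ∀ k ∈ S j, g j k ≤ m j := fun j k hk => by
    by_cases h : k ∈ T j
    exacts [(hm j k h).le, (hlt j k hk h).le]
  have hl' : ∀ c, (∀ j, c j ∈ stdSimplex ℝ (κ j)) →
      C + ∑ j, m j - l (M.toLin c) = ∑ j, ∑ k, c j k * (m j - g j k) := fun c hc => by
    rw [hl c hc]
    simp only [mul_sub, sum_sub_distrib, ← sum_mul, (hc _).2, one_mul]
    ring
  have hnn : ∀ c : ∀ j, κ j → ℝ, (∀ j, c j ∈ stdSimplex ℝ (κ j) ∧ ∀ k ∉ S j, c j k = 0) →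
      ∀ j k, 0 ≤ c j k * (m j - g j k) := fun c hc j k => by
    by_cases h : k ∈ S j
    · exact mul_nonneg ((hc j).1.1 k) (sub_nonneg.2 (hle j k h))
    · simp [(hc j).2 k h]
  have heq : ∀ c : ∀ j, κ j → ℝ, (∀ j, c j ∈ stdSimplex ℝ (κ j) ∧ ∀ k ∉ T j, c j k = 0) →
      C + ∑ j, m j - l (M.toLin c) = 0 := fun c hc => by
    rw [hl' c fun j => (hc j).1]
    refine sum_eq_zero fun j _ => sum_eq_zero fun k _ => ?_
    by_cases h : k ∈ T j
    · simp [hm j k h]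
    · simp [(hc j).2 k h]
  ext x
  constructor
  · rintro ⟨⟨c, hc, rfl⟩, hx⟩
    choose t ht using hT
    obtain ⟨c', hc', he⟩ := M.vertex_mem_face_iff.2 ht
    have h1 := hx (M.vertex t) (M.vertex_mem_face_iff.2 fun j => hTS j (ht j))
    have h2 := heq c' hc'
    rw [he] at h2
    have h3 := hl' c fun j => (hc j).1
    have h4 : ∑ j, ∑ k, c j k * (m j - g j k) = 0 :=
      le_antisymm (by linarith) (sum_nonneg fun j _ => sum_nonneg fun k _ => hnn c hc j k)
    rw [sum_eq_zero_iff_of_nonneg fun j _ => sum_nonneg fun k _ => hnn c hc j k] at h4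
    refine ⟨c, fun j => ⟨(hc j).1, fun k hk => ?_⟩, rfl⟩
    by_cases hkS : k ∈ S j
    · have h5 := h4 j (mem_univ j)
      rw [sum_eq_zero_iff_of_nonneg fun k _ => hnn c hc j k] at h5
      exact (mul_eq_zero.1 (h5 k (mem_univ k))).resolve_right (sub_pos.2 (hlt j k hkS hk)).ne'
    · exact (hc j).2 k hkS
  · rintro ⟨c, hc, rfl⟩
    refine ⟨⟨c, fun j => ⟨(hc j).1, fun k hk => (hc j).2 k fun h => hk (hTS j h)⟩, rfl⟩, ?_⟩
    rintro _ ⟨c', hc', rfl⟩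
    have h1 := heq c hc
    have h2 := hl' c' fun j => (hc' j).1
    have h3 : 0 ≤ ∑ j, ∑ k, c' j k * (m j - g j k) :=
      sum_nonneg fun j _ => sum_nonneg fun k _ => hnn c' hc' j k
    linarith

theorem isFace_face_iff {S : ∀ j, Finset (κ j)} (hS : ∀ j, (S j).Nonempty) {F : Set E} :
    IsFace (M.face S) F ↔ ∃ T : ∀ j, Finset (κ j), (∀ j, T j ⊆ S j) ∧ (∀ j, (T j).Nonempty) ∧
      F = M.face T := by
  constructor
  · intro hF
    obtain ⟨l, rfl⟩ := hF.exists_eq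
    let g : ∀ j, κ j → ℝ := fun j k => l (M.toLin (Pi.single j (Pi.single k 1)))
    choose t ht hmax using fun j => exists_max_image (S j) (g j) (hS j)
    have hl : ∀ c : ∀ j, κ j → ℝ, l (M.toLin c) = 0 + ∑ j, ∑ k, c j k * g j k := fun c => by
      have hc : c = ∑ j, ∑ k, c j k • Pi.single j (Pi.single k (1 : ℝ)) := by
        funext j k
        rw [Finset.sum_apply, Finset.sum_apply, sum_eq_single j (fun i _ hi => by simp [Ne.symm hi])
          (by simp), Finset.sum_apply, Finset.sum_apply]
        simp [Pi.single_apply]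
      conv_lhs => rw [hc]
      simp only [map_sum, map_smul, smul_eq_mul, zero_add, g]
    let T : ∀ j, Finset (κ j) := fun j => {k ∈ S j | g j k = g j (t j)}
    have hTS : ∀ j, T j ⊆ S j := fun j => filter_subset _ _
    have hT : ∀ j, (T j).Nonempty := fun j => ⟨t j, mem_filter.2 ⟨ht j, rfl⟩⟩
    refine ⟨T, hTS, hT, M.maximizers_eq_face hTS hT (fun c _ => hl c)
      (m := fun j => g j (t j)) (fun j k hk => (mem_filter.1 hk).2)
      fun j k hk hk' => (hmax j k hk).lt_of_ne fun h => hk' (mem_filter.2 ⟨hk, h⟩)⟩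
  · rintro ⟨T, hTS, hT, rfl⟩
    refine ⟨fun _ => ⟨∑ j, ∑ k ∈ T j, M.coord j k, ?_⟩, ?_⟩
    · symm
      refine M.maximizers_eq_face hTS hT (g := fun j k => if k ∈ T j then 1 else 0) (m := 1)
        (C := -∑ j, ∑ k ∈ T j, M.off j k) (fun c hc => ?_) (fun j k hk => by simp [hk])
        fun j k _ hk => by simp [hk]
      have : ∀ j k, M.coord j k (M.toLin c) = c j k - M.off j k := fun j k =>
        eq_sub_of_add_eq (M.coord_toLin c hc j k)
      simp [this, sum_sub_distrib]
      ring
    · choose t ht using hT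
      exact ⟨_, M.vertex_mem_face_iff.2 ht⟩

omit [Fintype ι] in
theorem face_subsingleton_iff {S : ∀ j, Finset (κ j)} (hS : ∀ j, (S j).Nonempty) :
    (M.face S).Subsingleton ↔ ∀ j, #(S j) = 1 := by
  constructor
  · intro h j
    rw [card_eq_one]
    choose s hs using hS
    refine ⟨s j, eq_singleton_iff_unique_mem.2 ⟨hs j, fun k hk => ?_⟩⟩
    have h1 : M.vertex (Function.update s j k) ∈ M.face S := M.vertex_mem_face_iff.2 fun i => by
      rcases eq_or_ne i j with rfl | hi
      · simpa using hk
      · simpa [hi] using hs i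
    have h2 := congrArg (M.coord j k) (h h1 (M.vertex_mem_face_iff.2 hs))
    rw [coord_vertex, coord_vertex] at h2
    by_contra hne
    simp [Ne.symm hne] at h2
  · rintro h _ ⟨c, hc, rfl⟩ _ ⟨c', hc', rfl⟩
    congr 1
    have key : ∀ c : ∀ j, κ j → ℝ, (∀ j, c j ∈ stdSimplex ℝ (κ j) ∧ ∀ k ∉ S j, c j k = 0) →
        ∀ j k, c j k = if k ∈ S j then 1 else 0 := fun c hc j k => by
      split_ifs with hk
      · obtain ⟨s, hs⟩ := card_eq_one.1 (h j)
        obtain rfl : k = s := by simpa [hs] using hk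
        rw [← (hc j).1.2]
        refine (sum_eq_single k (fun k' _ hk' => (hc j).2 k' ?_) (by simp)).symm
        simpa [hs] using hk'
      · exact (hc j).2 k hk
    funext j k
    rw [key c hc, key c' hc']

theorem apex_face [Nonempty ι] {V : Set E → E} (hV : IsApexAssignment M.polytope V)
    {S : ∀ j, Finset (κ j)} (hS : ∀ j, (S j).Nonempty) :
    ∃ q : ∀ j, κ j, (∀ j, q j ∈ S j) ∧ V (M.face S) = M.vertex q := by
  have hne : ∀ j, (univ : Finset (κ j)).Nonempty := fun j => (hS j).mono (subset_univ _)
  have hF : IsFace M.polytope (M.face S) := by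
    rw [← M.face_univ, M.isFace_face_iff hne]
    exact ⟨S, fun j => subset_univ _, hS, rfl⟩
  have hx := hV _ hF
  obtain ⟨μ, h0, -, h1, he⟩ := M.exists_chain_weights_of_mem (hF.1.subset hx.1)
  rw [← he] at hx
  obtain ⟨q, hq⟩ := hF.exists_eq_of_mem_extremePoints M.convex_polytope M.vertex_mem_polytope
    h0 h1 hx
  rw [← hq] at hx
  exact ⟨q, M.vertex_mem_face_iff.1 hx.1, by rw [← he, hq]⟩

end SimplexProductParam

section Unfold

variable {E : Type*} [AddCommGroup E] [Module ℝ E] [TopologicalSpace E] [FiniteDimensional ℝ E]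
  (V : Set E → E) (P : Set E)

theorem polytopeNumberPair_zero : polytopeNumberPair V P 0 = (0, 0) := by
  rw [polytopeNumberPair.eq_def]
  simp

theorem polytopeNumberPair_of_dim_eq_zero (h : polytopeDim P = 0) (n : ℕ) :
    polytopeNumberPair V P (n + 1) = (1, 1) := by
  rw [polytopeNumberPair.eq_def]
  simp [h]

theorem polytopeNumberPair_one (h : polytopeDim P ≠ 0) :
    polytopeNumberPair V P 1 = (1, 0) := by
  rw [polytopeNumberPair.eq_def]
  simp [h]

open Classical in
theorem polytopeNumberPair_add_two_fst (h : polytopeDim P ≠ 0) (n : ℕ) :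
    (polytopeNumberPair V P (n + 2)).1 = (polytopeNumberPair V P (n + 1)).1 +
      ∑ᶠ F : {F : Set E // IsProperFace P F},
        if V P ∈ F.1 then 0 else (polytopeNumberPair V F.1 (n + 2)).2 := by
  rw [polytopeNumberPair.eq_def]
  simp [h]

theorem polytopeNumberPair_add_two_snd (h : polytopeDim P ≠ 0) (n : ℕ) :
    (polytopeNumberPair V P (n + 2)).2 = (polytopeNumberPair V P (n + 2)).1 -
      ∑ᶠ F : {F : Set E // IsProperFace P F}, (polytopeNumberPair V F.1 (n + 2)).2 := by
  rw [polytopeNumberPair.eq_def]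
  simp [h]

end Unfold

namespace SimplexProductParam

variable {ι : Type*} [Fintype ι] [DecidableEq ι] {κ : ι → Type*} [∀ j, Fintype (κ j)]
  [∀ j, LinearOrder (κ j)] {E : Type*} [AddCommGroup E] [Module ℝ E] [TopologicalSpace E]
  (M : SimplexProductParam κ E)

/-- The tuples of nonempty subsets of the `S j`. -/
def subtuples (S : ∀ j, Finset (κ j)) : Finset (∀ j, Finset (κ j)) :=
  Fintype.piFinset fun j => {t ∈ (S j).powerset | t.Nonempty}

omit [∀ j, Fintype (κ j)] [∀ j, LinearOrder (κ j)] in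
theorem mem_subtuples {S T : ∀ j, Finset (κ j)} :
    T ∈ subtuples S ↔ (∀ j, T j ⊆ S j) ∧ ∀ j, (T j).Nonempty := by
  simp [subtuples, forall_and]

theorem isProperFace_face_iff {S : ∀ j, Finset (κ j)} (hS : ∀ j, (S j).Nonempty) {F : Set E} :
    IsProperFace (M.face S) F ↔ ∃ T ∈ (subtuples S).erase S, F = M.face T := by
  rw [IsProperFace, M.isFace_face_iff hS]
  constructor
  · rintro ⟨⟨T, hTS, hT, rfl⟩, hne⟩
    exact ⟨T, mem_erase.2 ⟨fun h => hne (by rw [h]), mem_subtuples.2 ⟨hTS, hT⟩⟩, rfl⟩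
  · rintro ⟨T, hT, rfl⟩
    obtain ⟨hne, hT⟩ := mem_erase.1 hT
    obtain ⟨hTS, hT⟩ := mem_subtuples.1 hT
    refine ⟨⟨T, hTS, hT, rfl⟩, fun h => hne ?_⟩
    exact funext fun j => (hTS j).antisymm (M.subset_of_face_subset hS h.ge j)

omit [Fintype ι] in
theorem face_injOn : Set.InjOn M.face {S | ∀ j, (S j).Nonempty} := fun _ hS _ hT h =>
  funext fun j => (M.subset_of_face_subset hS h.le j).antisymm (M.subset_of_face_subset hT h.ge j)

omit [∀ j, Fintype (κ j)] in
theorem sum_subtuples {S : ∀ j, Finset (κ j)} (hS : ∀ j, (S j).Nonempty) (m : ℕ) :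
    ∑ T ∈ subtuples S, ∏ j, m.choose (#(T j) - 1) =
      ∏ j, (m + 1 + (#(S j) - 1)).choose (#(S j) - 1) := by
  rw [subtuples, ← prod_univ_sum (fun j => {t ∈ (S j).powerset | t.Nonempty})
    fun _ t => m.choose (#t - 1)]
  exact prod_congr rfl fun j _ => sum_nonempty_powerset_choose (hS j) m

omit [∀ j, Fintype (κ j)] in
theorem sum_subtuples_mem {S : ∀ j, Finset (κ j)} {q : ∀ j, κ j} (hq : ∀ j, q j ∈ S j) (m : ℕ) :
    ∑ T ∈ subtuples S with ∀ j, q j ∈ T j, ∏ j, m.choose (#(T j) - 1) =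
      ∏ j, (m + (#(S j) - 1)).choose (#(S j) - 1) := by
  have : {T ∈ subtuples S | ∀ j, q j ∈ T j} =
      Fintype.piFinset fun j => {t ∈ (S j).powerset | t.Nonempty ∧ q j ∈ t} := by
    ext T
    simp [subtuples, forall_and, and_assoc]
  rw [this, ← prod_univ_sum (fun j => {t ∈ (S j).powerset | t.Nonempty ∧ q j ∈ t})
    fun _ t => m.choose (#t - 1)]
  exact prod_congr rfl fun j _ => sum_powerset_mem_choose (hq j) m

/-- The polytope numbers and interior polytope numbers of a product of simplices. -/
theorem polytopeNumberPair_face [FiniteDimensional ℝ E] [Nonempty ι] {V : Set E → E}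
    (hV : IsApexAssignment M.polytope V) (S : ∀ j, Finset (κ j)) (hS : ∀ j, (S j).Nonempty)
    (n : ℕ) : polytopeNumberPair V (M.face S) (n + 1) =
      (((∏ j, (n + (#(S j) - 1)).choose (#(S j) - 1) : ℕ) : ℤ),
        ((∏ j, (n - 1).choose (#(S j) - 1) : ℕ) : ℤ)) := by
  induction hc : ∑ j, #(S j) using Nat.strong_induction_on generalizing S n with
  | h c ih =>
  by_cases hdim : polytopeDim (M.face S) = 0
  · rw [polytopeNumberPair_of_dim_eq_zero _ _ hdim]
    rw [polytopeDim_eq_zero_iff, M.face_subsingleton_iff hS] at hdim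
    simp [hdim]
  induction n with
  | zero =>
    rw [polytopeNumberPair_one _ _ hdim]
    rw [polytopeDim_eq_zero_iff, M.face_subsingleton_iff hS, not_forall] at hdim
    obtain ⟨j, hj⟩ := hdim
    have := (hS j).card_pos
    have hz : ∏ j, (0 - 1).choose (#(S j) - 1) = 0 :=
      prod_eq_zero (mem_univ j) (Nat.choose_eq_zero_of_lt (by omega))
    rw [hz]
    simp
  | succ n ihn =>
    have hprop : ∀ F, IsProperFace (M.face S) F ↔ ∃ T ∈ (subtuples S).erase S, F = M.face T :=
      fun F => M.isProperFace_face_iff hS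
    have hinj : Set.InjOn M.face ((subtuples S).erase S : Finset _) :=
      M.face_injOn.mono fun T hT => (mem_subtuples.1 (mem_of_mem_erase (mem_coe.1 hT))).2
    have hSS : S ∈ subtuples S := mem_subtuples.2 ⟨fun _ => Subset.rfl, hS⟩
    have hsmall : ∀ T ∈ (subtuples S).erase S, (polytopeNumberPair V (M.face T) (n + 2)).2 =
        ((∏ j, n.choose (#(T j) - 1) : ℕ) : ℤ) := by
      intro T hT
      obtain ⟨hne, hT⟩ := mem_erase.1 hT
      obtain ⟨hTS, hT⟩ := mem_subtuples.1 hT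
      rw [ih (∑ j, #(T j)) ?_ T hT (n + 1) rfl, Nat.add_sub_cancel]
      rw [← hc]
      refine lt_of_le_of_ne (sum_le_sum fun j _ => card_le_card (hTS j)) fun h => hne ?_
      rw [sum_eq_sum_iff_of_le fun j _ => card_le_card (hTS j)] at h
      exact funext fun j => eq_of_subset_of_card_le (hTS j) (h j (mem_univ j)).ge
    obtain ⟨q, hq, hVq⟩ := M.apex_face hV hS
    have hfst : (polytopeNumberPair V (M.face S) (n + 2)).1 =
        ((∏ j, (n + 1 + (#(S j) - 1)).choose (#(S j) - 1) : ℕ) : ℤ) := by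
      classical
      rw [polytopeNumberPair_add_two_fst _ _ hdim, ihn, finsum_isProperFace_eq hinj hprop fun F =>
        if V (M.face S) ∈ F then 0 else (polytopeNumberPair V F (n + 2)).2,
        sum_congr rfl fun T hT => by rw [hsmall T hT], hVq]
      simp only [M.vertex_mem_face_iff]
      rw [sum_erase _ (by simp [hq]), ← sum_subtuples hS, ← sum_subtuples_mem hq]
      push_cast
      rw [sum_filter, ← sum_add_distrib]
      refine sum_congr rfl fun T _ => ?_
      by_cases h : ∀ j, q j ∈ T j <;> simp [h]
    refine Prod.ext hfst ?_
    rw [polytopeNumberPair_add_two_snd _ _ hdim, hfst, finsum_isProperFace_eq hinj hprop fun F =>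
      (polytopeNumberPair V F (n + 2)).2, sum_congr rfl hsmall, ← sum_subtuples hS,
      ← add_sum_erase _ _ hSS]
    push_cast
    simp

theorem polytopeNumber_polytope [FiniteDimensional ℝ E] [Nonempty ι] [∀ j, Nonempty (κ j)]
    {V : Set E → E} (hV : IsApexAssignment M.polytope V) (n : ℕ) :
    polytopeNumber V M.polytope (n + 1) =
      ((∏ j, (n + (Fintype.card (κ j) - 1)).choose (Fintype.card (κ j) - 1) : ℕ) : ℤ) := by
  rw [polytopeNumber, ← M.face_univ, M.polytopeNumberPair_face hV _ fun j => univ_nonempty]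
  rfl

end SimplexProductParam

theorem polytopeNumber_zero {E : Type*} [AddCommGroup E] [Module ℝ E] [TopologicalSpace E]
    [FiniteDimensional ℝ E] (V : Set E → E) (P : Set E) : polytopeNumber V P 0 = 0 := by
  rw [polytopeNumber, polytopeNumberPair_zero]

/-- The standard simplex, as a product with one factor. -/
noncomputable def stdSimplexParam (N : ℕ) :
    SimplexProductParam (fun _ : Unit => Fin (N + 1)) (Fin (N + 1) → ℝ) where
  toLin := LinearMap.proj ()
  coord _ k := ContinuousLinearMap.proj k
  off _ _ := 0
  coord_toLin c _ j k := by simp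

theorem stdSimplexParam_polytope (N : ℕ) :
    (stdSimplexParam N).polytope = stdSimplex ℝ (Fin (N + 1)) := by
  ext x
  constructor
  · rintro ⟨c, hc, rfl⟩
    exact hc () trivial
  · exact fun hx => ⟨fun _ => x, fun _ _ => hx, rfl⟩

theorem polytopeNumber_stdSimplex {N : ℕ} {W : (Set (Fin (N + 1) → ℝ)) → Fin (N + 1) → ℝ}
    (hW : IsApexAssignment (stdSimplex ℝ (Fin (N + 1))) W) (n : ℕ) :
    polytopeNumber W (stdSimplex ℝ (Fin (N + 1))) (n + 1) = ((n + N).choose N : ℕ) := by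
  rw [← stdSimplexParam_polytope] at hW ⊢
  rw [(stdSimplexParam N).polytopeNumber_polytope hW]
  simp

section Worpitzky

variable {l : ℕ}

/-- The number of occurrences of every letter in a word. -/
def content {N : ℕ} (w : Fin N → Fin l) (j : Fin l) : ℕ := #{k | w k = j}

/-- The number of descents of the word `w` with a letter `t` put in front of it. -/
def descentCountFrom {N : ℕ} (w : Fin N → Fin l) (t : ℕ) : ℕ :=
  descentCount w + #{k : Fin N | (k : ℕ) = 0 ∧ (w k : ℕ) < t}

theorem content_cons {N : ℕ} (c : Fin l) (w : Fin N → Fin l) :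
    content (Fin.cons c w : Fin (N + 1) → Fin l) = content w + Pi.single c 1 := by
  funext j
  simp only [content, card_filter, Fin.sum_univ_succ, Fin.cons_zero, Fin.cons_succ, Pi.add_apply,
    Pi.single_apply]
  rw [add_comm]
  simp [eq_comm]

theorem descentCount_cons {N : ℕ} (c : Fin l) (w : Fin N → Fin l) :
    descentCount (Fin.cons c w : Fin (N + 1) → Fin l) = descentCountFrom w c := by
  simp only [descentCountFrom, descentCount, card_filter, ← univ_product_univ, sum_product,
    Fin.sum_univ_succ, Fin.cons_zero, Fin.cons_succ, Fin.val_zero, Fin.val_succ]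
  simp
  exact add_comm _ _

theorem descentCountFrom_cons {N : ℕ} (c : Fin l) (w : Fin N → Fin l) (t : ℕ) :
    descentCountFrom (Fin.cons c w : Fin (N + 1) → Fin l) t =
      descentCountFrom w c + if (c : ℕ) < t then 1 else 0 := by
  rw [descentCountFrom, descentCount_cons, card_filter, Fin.sum_univ_succ]
  simp

theorem descentCountFrom_le {N : ℕ} (w : Fin N → Fin l) (t : ℕ) : descentCountFrom w t ≤ N := by
  induction N generalizing t with
  | zero => simp [descentCountFrom, descentCount]
  | succ N ih =>
    rw [← Fin.cons_self_tail w, descentCountFrom_cons]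
    have := ih (Fin.tail w) (w 0)
    split_ifs <;> omega

/-- The sum of `C(m + N - des, N)` over the words of length `N` and content `d`, where `des` counts
descents after a letter `t` has been put in front. -/
def wordSum (N : ℕ) (d : Fin l → ℕ) (m t : ℕ) : ℕ :=
  ∑ w : Fin N → Fin l with content w = d, (m + N - descentCountFrom w t).choose N

theorem wordSum_succ (N : ℕ) (d : Fin l → ℕ) (m t : ℕ) : wordSum (N + 1) d m t =
    ∑ c : Fin l, ∑ w : Fin N → Fin l with content w + Pi.single c 1 = d,
      (m + (N + 1) - (descentCountFrom w c + if (c : ℕ) < t then 1 else 0)).choose (N + 1) := by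
  have hcons : ∀ (c : Fin l) (w : Fin N → Fin l),
      Fin.consEquiv (fun _ => Fin l) (c, w) = Fin.cons c w := fun _ _ => rfl
  rw [wordSum, sum_filter, ← (Fin.consEquiv fun _ => Fin l).sum_comp, Fintype.sum_prod_type]
  simp only [hcons, content_cons, descentCountFrom_cons, sum_filter]

theorem wordSum_succ_top (N : ℕ) (d : Fin l → ℕ) (m : ℕ) :
    wordSum (N + 1) d (m + 1) l = wordSum (N + 1) d m 0 := by
  rw [wordSum_succ, wordSum_succ]
  refine sum_congr rfl fun c _ => sum_congr rfl fun w _ => ?_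
  rw [if_pos c.2, if_neg (Nat.not_lt_zero _)]
  congr 1
  omega

theorem wordSum_zero_top (N : ℕ) (d : Fin l → ℕ) : wordSum (N + 1) d 0 l = 0 := by
  rw [wordSum_succ]
  refine sum_eq_zero fun c _ => sum_eq_zero fun w _ => Nat.choose_eq_zero_of_lt ?_
  rw [if_pos c.2]
  omega

theorem wordSum_succ_step (N : ℕ) (d : Fin l → ℕ) (m : ℕ) (t : Fin l) :
    wordSum (N + 1) d m t = wordSum (N + 1) d m (t + 1) +
      ∑ w : Fin N → Fin l with content w + Pi.single t 1 = d,
        (m + N - descentCountFrom w t).choose N := by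
  have key : ∀ (f g : Fin l → ℕ) (h : ℕ), f t = g t + h → (∀ c ≠ t, f c = g c) →
      ∑ c, f c = ∑ c, g c + h := fun f g h ht hc => by
    rw [← add_sum_erase _ _ (mem_univ t), ← add_sum_erase univ g (mem_univ t), ht,
      sum_congr rfl fun c hc' => hc c (mem_erase.1 hc').1]
    ring
  rw [wordSum_succ, wordSum_succ]
  refine key _ _ _ ?_ fun c hc => ?_
  · rw [← sum_add_distrib]
    refine sum_congr rfl fun w _ => ?_
    have := descentCountFrom_le w t
    rw [if_neg (lt_irrefl _), if_pos (Nat.lt_succ_self _), add_comm (Nat.choose _ _),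
      show m + (N + 1) - (descentCountFrom w t + 0) = m + N - descentCountFrom w t + 1 by omega,
      show m + (N + 1) - (descentCountFrom w t + 1) = m + N - descentCountFrom w t by omega,
      Nat.choose_succ_succ]
  · refine sum_congr rfl fun w _ => ?_
    have hne : (c : ℕ) ≠ t := fun h => hc (Fin.ext h)
    have : ((c : ℕ) < t) = ((c : ℕ) < t + 1) := propext (by omega)
    simp only [this]

/-- A product of binomial coefficients, with shifted arguments below the threshold `t`. -/
def binomialProduct (d : Fin l → ℕ) (m t : ℕ) : ℕ :=
  ∏ j : Fin l, if t ≤ j then (m + d j).choose (d j) else (m + d j - 1).choose (d j)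

theorem binomialProduct_succ_top (d : Fin l → ℕ) (m : ℕ) :
    binomialProduct d (m + 1) l = binomialProduct d m 0 := by
  refine prod_congr rfl fun j _ => ?_
  rw [if_neg (not_le.2 j.2), if_pos (Nat.zero_le _)]
  congr 1
  omega

theorem binomialProduct_zero_top {d : Fin l → ℕ} {j : Fin l} (hj : 0 < d j) :
    binomialProduct d 0 l = 0 := by
  refine prod_eq_zero (mem_univ j) ?_
  rw [if_neg (not_le.2 j.2)]
  exact Nat.choose_eq_zero_of_lt (by omega)

theorem binomialProduct_step_of_eq_zero {d : Fin l → ℕ} {t : Fin l} (ht : d t = 0) (m : ℕ) :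
    binomialProduct d m t = binomialProduct d m (t + 1) := by
  refine prod_congr rfl fun j _ => ?_
  rcases eq_or_ne j t with rfl | hj
  · simp [ht]
  · have hj : (j : ℕ) ≠ t := fun h => hj (Fin.ext h)
    have : ((t : ℕ) ≤ j) = ((t : ℕ) + 1 ≤ j) := propext (by omega)
    simp only [this]

theorem binomialProduct_step (d : Fin l → ℕ) (t : Fin l) (m : ℕ) :
    binomialProduct (d + Pi.single t 1) m t =
      binomialProduct (d + Pi.single t 1) m (t + 1) + binomialProduct d m t := by
  have h : ∀ (d : Fin l → ℕ) s, binomialProduct d m s =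
      (if s ≤ t then (m + d t).choose (d t) else (m + d t - 1).choose (d t)) *
        ∏ j ∈ univ.erase t, if s ≤ j then (m + d j).choose (d j) else (m + d j - 1).choose (d j) :=
    fun d s => (mul_prod_erase _ _ (mem_univ t)).symm
  have h1 : ∏ j ∈ univ.erase t, (if (t : ℕ) ≤ j then
        (m + (d + Pi.single t 1 : Fin l → ℕ) j).choose ((d + Pi.single t 1 : Fin l → ℕ) j)
      else (m + (d + Pi.single t 1 : Fin l → ℕ) j - 1).choose ((d + Pi.single t 1 : Fin l → ℕ) j)) =
      ∏ j ∈ univ.erase t,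
        if (t : ℕ) ≤ j then (m + d j).choose (d j) else (m + d j - 1).choose (d j) :=
    prod_congr rfl fun j hj => by simp [(mem_erase.1 hj).1]
  have h2 : ∏ j ∈ univ.erase t, (if (t : ℕ) + 1 ≤ j then
        (m + (d + Pi.single t 1 : Fin l → ℕ) j).choose ((d + Pi.single t 1 : Fin l → ℕ) j)
      else (m + (d + Pi.single t 1 : Fin l → ℕ) j - 1).choose ((d + Pi.single t 1 : Fin l → ℕ) j)) =
      ∏ j ∈ univ.erase t,
        if (t : ℕ) ≤ j then (m + d j).choose (d j) else (m + d j - 1).choose (d j) :=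
    prod_congr rfl fun j hj => by
      have hne : (j : ℕ) ≠ t := fun h => (mem_erase.1 hj).1 (Fin.ext h)
      have : ((t : ℕ) ≤ j) = ((t : ℕ) + 1 ≤ j) := propext (by omega)
      simp [(mem_erase.1 hj).1, this]
  rw [h, h _ (t + 1), h d, h1, h2, ← add_mul]
  congr 1
  simp only [le_refl, if_true, Pi.add_apply, Pi.single_eq_same]
  rw [if_neg (by omega), ← add_assoc, Nat.add_sub_cancel, Nat.choose_succ_succ, add_comm]

theorem wordSum_eq_binomialProduct (N : ℕ) (d : Fin l → ℕ) (hd : ∑ j, d j = N) (m t : ℕ)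
    (ht : t ≤ l) : wordSum N d m t = binomialProduct d m t := by
  induction N generalizing d m t with
  | zero =>
    have hd0 : d = 0 := funext fun j => by simpa using (sum_eq_zero_iff.1 hd) j (mem_univ j)
    subst hd0
    have : ∀ w : Fin 0 → Fin l, content w = 0 := fun w => funext fun j => by simp [content]
    simp [wordSum, binomialProduct, this]
  | succ N ihN =>
    have hstep : ∀ (m : ℕ), wordSum (N + 1) d m l = binomialProduct d m l →
        ∀ t ≤ l, wordSum (N + 1) d m t = binomialProduct d m t := by
      intro m hm t ht
      induction ht using Nat.decreasingInduction with
      | self => exact hm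
      | of_succ t ht ih =>
        have hs := wordSum_succ_step N d m ⟨t, ht⟩
        rw [ih] at hs
        rw [hs]
        by_cases h0 : d ⟨t, ht⟩ = 0
        · rw [← binomialProduct_step_of_eq_zero h0, filter_false_of_mem, sum_empty, add_zero]
          rintro w - rfl
          simp at h0
        · have hex : ∃ e : Fin l → ℕ, d = e + Pi.single ⟨t, ht⟩ 1 := by
            refine ⟨fun j => d j - (Pi.single ⟨t, ht⟩ 1 : Fin l → ℕ) j, funext fun j => ?_⟩
            rcases eq_or_ne j ⟨t, ht⟩ with rfl | hj
            · simp only [Pi.add_apply, Pi.single_eq_same]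
              omega
            · simp [hj]
          obtain ⟨e, he⟩ := hex
          subst he
          have he : ∑ j, e j = N := by simpa [sum_add_distrib] using hd
          have hse := ihN e he m t ht.le
          rw [wordSum] at hse
          simp only [add_left_inj]
          rw [hse]
          exact (binomialProduct_step e ⟨t, ht⟩ m).symm
    induction m generalizing t with
    | zero =>
      refine hstep 0 ?_ t ht
      have : ∃ j, 0 < d j := by
        by_contra! h
        rw [sum_eq_zero fun j _ => Nat.le_zero.1 (h j)] at hd
        omega
      obtain ⟨j, hj⟩ := this
      rw [wordSum_zero_top, binomialProduct_zero_top hj]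
    | succ m ihm =>
      refine hstep (m + 1) ?_ t ht
      rw [wordSum_succ_top, binomialProduct_succ_top, ihm 0 (Nat.zero_le _)]

/-- The generalized Worpitzky identity. -/
theorem sum_content_choose {N : ℕ} {d : Fin l → ℕ} (hd : ∑ j, d j = N) (m : ℕ) :
    ∑ w : Fin N → Fin l with content w = d, (m + N - descentCount w).choose N =
      ∏ j, (m + d j).choose (d j) := by
  have := wordSum_eq_binomialProduct N d hd m 0 (Nat.zero_le _)
  simpa [wordSum, binomialProduct, descentCountFrom] using this

theorem descentCount_lt {N : ℕ} (hN : 1 ≤ N) (w : Fin N → Fin l) : descentCount w < N := by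
  obtain ⟨N, rfl⟩ := Nat.exists_eq_add_of_le' hN
  rw [← Fin.cons_self_tail w, descentCount_cons]
  exact Nat.lt_succ_of_le (descentCountFrom_le _ _)

/-- The generalized Worpitzky identity, summed by the number of descents. -/
theorem sum_card_descentCount_mul {N : ℕ} (hN : 1 ≤ N) {d : Fin l → ℕ} (hd : ∑ j, d j = N)
    {α : ℕ → ℤ} (h0 : α 0 = 0) (hα : ∀ n, α (n + 1) = ((n + N).choose N : ℕ)) (m : ℕ) :
    ∑ i ∈ range N, (#{w : Fin N → Fin l | content w = d ∧ descentCount w = i} : ℤ) *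
      α (m + 1 - i) = ((∏ j, (m + d j).choose (d j) : ℕ) : ℤ) := by
  have hα' : ∀ i, i < N → α (m + 1 - i) = ((m + N - i).choose N : ℕ) := fun i hi => by
    by_cases h : i ≤ m
    · rw [show m + 1 - i = (m - i) + 1 by omega, hα, show m - i + N = m + N - i by omega]
    · rw [show m + 1 - i = 0 by omega, h0, Nat.choose_eq_zero_of_lt (by omega)]
      rfl
  rw [← sum_content_choose hd, ← sum_fiberwise_of_maps_to (t := range N) (g := descentCount)
    fun w _ => mem_range.2 (descentCount_lt hN w)]
  push_cast
  refine sum_congr rfl fun i hi => ?_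
  rw [hα' i (mem_range.1 hi), filter_filter, ← nsmul_eq_mul, ← sum_const]
  refine sum_congr rfl fun w hw => ?_
  rw [(mem_filter.1 hw).2.2]

end Worpitzky

section SimplexProducts

variable {l : ℕ} (d : Fin l → ℕ)

/-- The product of standard simplices, parametrized by itself. -/
noncomputable def simplexProductParam : SimplexProductParam (fun j => Fin (d j + 1))
    ((j : Fin l) → Fin (d j + 1) → ℝ) where
  toLin := LinearMap.id
  coord j k := (ContinuousLinearMap.proj (R := ℝ) (φ := fun _ : Fin (d j + 1) => ℝ) k).comp
    (ContinuousLinearMap.proj (R := ℝ) (φ := fun j => Fin (d j + 1) → ℝ) j)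
  off _ _ := 0
  coord_toLin c _ j k := by simp

theorem simplexProductParam_polytope : (simplexProductParam d).polytope = simplexProduct d := by
  simp [SimplexProductParam.polytope, simplexProductParam, simplexProduct]

theorem coe_productSimplex {w : Fin (∑ j, d j) → Fin l} (hw : ∀ j, #{k | w k = j} = d j) :
    (productSimplex d w : Set _) = Set.range fun i : Fin ((∑ j, d j) + 1) =>
      (simplexProductParam d).vertex (pathPoint hw i) := by
  rw [productSimplex, coe_image, coe_univ, Set.image_univ]
  congr 1
  funext i j m
  simp [SimplexProductParam.vertex, simplexProductParam, Pi.single_apply, pathPoint, prefixCount,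
    Fin.ext_iff]

theorem exists_pointed_triangulation_simplexProduct (hd : 1 ≤ ∑ j, d j) :
    ∃ V K, IsPointedTriangulation (simplexProduct d) V K ∧
      K.facets = {s | ∃ w, IsMultisetPerm d w ∧ s = productSimplex d w} := by
  obtain ⟨V, K, hK, hfac⟩ :=
    (simplexProductParam d).exists_pointed_staircase_triangulation rfl hd
  rw [simplexProductParam_polytope] at hK
  refine ⟨V, K, hK, Set.ext fun s => ?_⟩
  rw [hfac]
  constructor
  · rintro ⟨w, hw, hs⟩
    exact ⟨w, hw, by rw [← coe_inj, hs, coe_productSimplex d hw]⟩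
  · rintro ⟨w, hw, rfl⟩
    exact ⟨w, hw, coe_productSimplex d hw⟩

theorem polytopeNumber_simplexProduct (hd : 1 ≤ ∑ j, d j)
    {V : Set ((j : Fin l) → Fin (d j + 1) → ℝ) → (j : Fin l) → Fin (d j + 1) → ℝ}
    (hV : IsApexAssignment (simplexProduct d) V)
    {W : Set (Fin ((∑ j, d j) + 1) → ℝ) → Fin ((∑ j, d j) + 1) → ℝ}
    (hW : IsApexAssignment (stdSimplex ℝ (Fin ((∑ j, d j) + 1))) W) (n : ℕ) :
    polytopeNumber V (simplexProduct d) n = ∑ i ∈ range (∑ j, d j),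
      (generalizedEulerianNumber d i : ℤ) *
        polytopeNumber W (stdSimplex ℝ (Fin ((∑ j, d j) + 1))) (n - i) := by
  have hne : Nonempty (Fin l) := by
    by_contra h
    rw [not_nonempty_iff] at h
    simp at hd
  cases n with
  | zero => simp [polytopeNumber_zero]
  | succ n =>
    have h := sum_card_descentCount_mul hd rfl (polytopeNumber_zero W _)
      (polytopeNumber_stdSimplex hW) n
    rw [← simplexProductParam_polytope] at hV ⊢
    rw [(simplexProductParam d).polytopeNumber_polytope hV]
    simp only [Fintype.card_fin, Nat.add_sub_cancel]
    rw [← h]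
    refine sum_congr rfl fun i _ => ?_
    congr 2
    rw [generalizedEulerianNumber]
    congr 1
    classical
    ext w
    rw [mem_filter, mem_filter]
    simp only [IsMultisetPerm, content, funext_iff]

end SimplexProducts

section Boxes

variable {d : ℕ} {a b : Fin d → ℝ}

/-- A box, parametrized by a product of one-dimensional simplices. -/
noncomputable def boxParam (h : ∀ i, a i < b i) :
    SimplexProductParam (fun _ : Fin d => Fin (1 + 1)) (Fin d → ℝ) where
  toLin := LinearMap.pi fun j => (a j • LinearMap.proj 0 + b j • LinearMap.proj 1) ∘ₗ
    LinearMap.proj (R := ℝ) (φ := fun _ => Fin (1 + 1) → ℝ) j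
  coord j k := (if k = 0 then -(b j - a j)⁻¹ else (b j - a j)⁻¹) • ContinuousLinearMap.proj j
  off j k := if k = 0 then (b j - a j)⁻¹ * b j else -((b j - a j)⁻¹ * a j)
  coord_toLin c hc j k := by
    have h1 := (hc j).2
    have h2 : b j - a j ≠ 0 := (sub_pos.2 (h j)).ne'
    rw [Fin.sum_univ_two] at h1
    have h3 : c j 0 = 1 - c j 1 := eq_sub_of_add_eq h1
    fin_cases k <;> simp [h3] <;> field_simp <;> ring

theorem boxParam_apply (h : ∀ i, a i < b i) (c : Fin d → Fin (1 + 1) → ℝ) (j : Fin d) :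
    (boxParam h).toLin c j = a j * c j 0 + b j * c j 1 := rfl

theorem boxParam_polytope (h : ∀ i, a i < b i) : (boxParam h).polytope = measurePolytope a b := by
  ext x
  constructor
  · rintro ⟨c, hc, rfl⟩ j -
    have h0 := (hc j trivial).1 0
    have h1 := (hc j trivial).1 1
    have h2 := (hc j trivial).2
    rw [Fin.sum_univ_two] at h2
    have h3 : c j 0 = 1 - c j 1 := eq_sub_of_add_eq h2
    rw [h3] at h0
    rw [boxParam_apply, h3]
    have := h j
    constructor <;> nlinarith
  · intro hx
    refine ⟨fun j => ![(b j - x j) / (b j - a j), (x j - a j) / (b j - a j)], fun j _ => ?_, ?_⟩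
    · have h1 := sub_pos.2 (h j)
      obtain ⟨h2, h3⟩ := hx j trivial
      refine ⟨fun k => ?_, ?_⟩
      · fin_cases k
        · exact div_nonneg (sub_nonneg.2 h3) h1.le
        · exact div_nonneg (sub_nonneg.2 h2) h1.le
      · rw [Fin.sum_univ_two]
        simp only [Matrix.cons_val_zero, Matrix.cons_val_one]
        field_simp
        ring
    · funext j
      have h1 := (sub_pos.2 (h j)).ne'
      rw [boxParam_apply]
      simp only [Matrix.cons_val_zero, Matrix.cons_val_one]
      field_simp
      ring

theorem card_fiber_perm (σ : Equiv.Perm (Fin d)) (j : Fin d) : #{k | σ k = j} = 1 := by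
  rw [card_eq_one]
  refine ⟨σ.symm j, ?_⟩
  ext k
  simp [Equiv.eq_symm_apply]

theorem exists_perm_of_card_fiber {w : Fin d → Fin d} (hw : ∀ j, #{k | w k = j} = 1) :
    ∃ σ : Equiv.Perm (Fin d), ⇑σ = w := by
  have : Function.Bijective w := by
    rw [Function.bijective_iff_existsUnique]
    intro j
    obtain ⟨k, hk⟩ := card_eq_one.1 (hw j)
    refine ⟨k, ?_, fun k' hk' => ?_⟩
    · simpa using (hk ▸ mem_singleton_self k : k ∈ ({k | w k = j} : Finset _))
    · simpa [hk] using (by simpa using hk' : k' ∈ ({k | w k = j} : Finset _))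
  exact ⟨Equiv.ofBijective w this, rfl⟩

theorem prefixCount_perm (σ : Equiv.Perm (Fin d)) (i : ℕ) (j : Fin d) :
    prefixCount σ i j = if (σ.symm j : ℕ) < i then 1 else 0 := by
  have : ({k | (k : ℕ) < i ∧ σ k = j} : Finset (Fin d)) =
      if (σ.symm j : ℕ) < i then {σ.symm j} else ∅ := by
    ext k
    rw [mem_filter, ← Equiv.eq_symm_apply]
    split_ifs with h
    · simp only [mem_univ, true_and, mem_singleton, and_iff_right_iff_imp]
      rintro rfl
      exact h
    · simp only [mem_univ, true_and, notMem_empty, iff_false, not_and]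
      rintro h1 rfl
      exact h h1
  rw [prefixCount, this]
  split_ifs <;> simp

theorem coe_boxSimplex (h : ∀ i, a i < b i) {σ : Equiv.Perm (Fin d)}
    (hw : ∀ j, #{k | σ k = j} = (fun _ : Fin d => 1) j) :
    (boxSimplex a b σ : Set _) = Set.range fun i : Fin (d + 1) =>
      (boxParam h).vertex (pathPoint hw i) := by
  rw [boxSimplex, coe_image, coe_univ, Set.image_univ]
  congr 1
  funext i j
  rw [SimplexProductParam.vertex, boxParam_apply]
  have := prefixCount_perm σ i j
  split_ifs at this ⊢ with hij
  · have hp : pathPoint hw i j = 1 := Fin.ext this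
    simp [hp]
  · have hp : pathPoint hw i j = 0 := Fin.ext this
    simp [hp]

theorem exists_pointed_triangulation_measurePolytope (hd : 1 ≤ d) (h : ∀ i, a i < b i) :
    ∃ V K, IsPointedTriangulation (measurePolytope a b) V K ∧
      K.facets = {s | ∃ σ : Equiv.Perm (Fin d), s = boxSimplex a b σ} := by
  obtain ⟨V, K, hK, hfac⟩ :=
    (boxParam h).exists_pointed_staircase_triangulation (d := fun _ => 1) (N := d) (by simp) hd
  rw [boxParam_polytope] at hK
  refine ⟨V, K, hK, Set.ext fun s => ?_⟩
  rw [hfac]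
  constructor
  · rintro ⟨w, hw, hs⟩
    obtain ⟨σ, rfl⟩ := exists_perm_of_card_fiber hw
    exact ⟨σ, by rw [← coe_inj, hs, coe_boxSimplex h hw]⟩
  · rintro ⟨σ, rfl⟩
    exact ⟨σ, card_fiber_perm σ, coe_boxSimplex h (card_fiber_perm σ)⟩

theorem eulerianNumber_eq_card (i : ℕ) : eulerianNumber d i =
    #{w : Fin d → Fin d | content w = (fun _ => 1) ∧ descentCount w = i} := by
  rw [eulerianNumber]
  refine card_bij (fun σ _ => σ) (fun σ hσ => ?_) (fun σ _ τ _ h => DFunLike.coe_injective h)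
    fun w hw => ?_
  · rw [mem_filter] at hσ ⊢
    exact ⟨mem_univ _, funext fun j => card_fiber_perm σ j, hσ.2⟩
  · obtain ⟨-, h1, h2⟩ := mem_filter.1 hw
    obtain ⟨σ, rfl⟩ := exists_perm_of_card_fiber fun j => congrFun h1 j
    exact ⟨σ, mem_filter.2 ⟨mem_univ _, h2⟩, rfl⟩

theorem polytopeNumber_measurePolytope (hd : 1 ≤ d) (h : ∀ i, a i < b i)
    {V : Set (Fin d → ℝ) → Fin d → ℝ} (hV : IsApexAssignment (measurePolytope a b) V)
    {W : Set (Fin (d + 1) → ℝ) → Fin (d + 1) → ℝ}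
    (hW : IsApexAssignment (stdSimplex ℝ (Fin (d + 1))) W) (n : ℕ) :
    polytopeNumber V (measurePolytope a b) n = ∑ i ∈ range d,
      (eulerianNumber d i : ℤ) * polytopeNumber W (stdSimplex ℝ (Fin (d + 1))) (n - i) := by
  have hne : Nonempty (Fin d) := ⟨⟨0, hd⟩⟩
  cases n with
  | zero => simp [polytopeNumber_zero]
  | succ n =>
    have hs := sum_card_descentCount_mul (l := d) hd (d := fun _ => 1) (by simp)
      (polytopeNumber_zero W _) (polytopeNumber_stdSimplex hW) n
    rw [← boxParam_polytope h] at hV ⊢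
    rw [(boxParam h).polytopeNumber_polytope hV]
    simp only [eulerianNumber_eq_card]
    rw [hs]
    simp

end Boxes

section CrossTriangulation

variable {d : ℕ}

theorem single_mem_crossPolytope (i : Fin d) (s : ℤˣ) :
    Pi.single i ((s : ℤ) : ℝ) ∈ crossPolytope d := by
  refine subset_convexHull ℝ _ ?_
  rcases Int.units_eq_one_or s with rfl | rfl
  · exact .inl ⟨i, by simp⟩
  · exact .inr ⟨i, by simp [Pi.single_neg]⟩

theorem sum_abs_le_of_mem_crossPolytope {x : Fin d → ℝ} (hx : x ∈ crossPolytope d) :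
    ∑ i, |x i| ≤ 1 := by
  have hconv : Convex ℝ {x : Fin d → ℝ | ∑ i, |x i| ≤ 1} := by
    intro x hx y hy a b ha hb hab
    simp only [Set.mem_ofPred_eq, Pi.add_apply, Pi.smul_apply, smul_eq_mul] at *
    calc ∑ i, |a * x i + b * y i| ≤ ∑ i, (a * |x i| + b * |y i|) :=
          sum_le_sum fun i _ => (abs_add_le _ _).trans
            (by rw [abs_mul, abs_mul, abs_of_nonneg ha, abs_of_nonneg hb])
      _ = a * ∑ i, |x i| + b * ∑ i, |y i| := by rw [sum_add_distrib, mul_sum, mul_sum]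
      _ ≤ 1 := by nlinarith
  refine convexHull_min ?_ hconv hx
  rintro _ (⟨i, rfl⟩ | ⟨i, rfl⟩)
  · have : ∀ k, |(Pi.single i 1 : Fin d → ℝ) k| = if k = i then 1 else 0 := fun k => by
      rw [Pi.single_apply]
      split_ifs <;> simp
    refine (sum_congr rfl fun k _ => this k).le.trans ?_
    simp
  · have : ∀ k, |(-Pi.single i 1 : Fin d → ℝ) k| = if k = i then 1 else 0 := fun k => by
      rw [Pi.neg_apply, Pi.single_apply]
      split_ifs <;> simp
    refine (sum_congr rfl fun k _ => this k).le.trans ?_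
    simp

/-- The vertices of the cross polytope. -/
def crossVertex (q : Fin d × ℤˣ) : Fin d → ℝ := Pi.single q.1 ((q.2 : ℤ) : ℝ)

theorem sum_smul_crossVertex (μ : Fin d × ℤˣ → ℝ) (i : Fin d) :
    (∑ q, μ q • crossVertex q) i = μ (i, 1) - μ (i, -1) := by
  simp only [Fintype.sum_prod_type, UnitsInt.univ, crossVertex, Finset.sum_apply, Pi.smul_apply,
    Pi.single_apply, smul_eq_mul]
  rw [sum_comm]
  rw [sum_pair (by decide)]
  simp [sub_eq_add_neg]

theorem sum_units_prod (μ : Fin d × ℤˣ → ℝ) : ∑ q, μ q = ∑ i, (μ (i, 1) + μ (i, -1)) := by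
  simp only [Fintype.sum_prod_type, UnitsInt.univ]
  exact sum_congr rfl fun i _ => sum_pair (by decide)

/-- The vertex sets of the simplices of the triangulation of the cross polytope: they contain no
two opposite vertices, except possibly those on the last axis. -/
def crossFamily (d : ℕ) : Set (Finset (Fin (d + 1) × ℤˣ)) :=
  {C | ∀ i : Fin d, ¬ ((i.castSucc, 1) ∈ C ∧ (i.castSucc, -1) ∈ C)}

theorem hasUniqueWeights_crossFamily : HasUniqueWeights (crossVertex (d := d + 1))
    (crossFamily d) := by
  intro μ ν hμ0 hν0 hμ hν h1 h
  have hdiff : ∀ i, μ (i, 1) - μ (i, -1) = ν (i, 1) - ν (i, -1) := fun i => by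
    rw [← sum_smul_crossVertex, h, sum_smul_crossVertex]
  have hz : ∀ ρ : Fin (d + 1) × ℤˣ → ℝ, ({q | ρ q ≠ 0} : Finset _) ∈ crossFamily d → ∀ i : Fin d,
      ρ (i.castSucc, 1) = 0 ∨ ρ (i.castSucc, -1) = 0 := fun ρ hρ i => by
    have := hρ i
    simp only [mem_filter, mem_univ, true_and] at this
    tauto
  have hcast : ∀ i : Fin d, μ (i.castSucc, 1) = ν (i.castSucc, 1) ∧
      μ (i.castSucc, -1) = ν (i.castSucc, -1) := fun i => by
    have a1 : 0 ≤ μ (i.castSucc, 1) := hμ0 _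
    have a2 : 0 ≤ μ (i.castSucc, -1) := hμ0 _
    have a3 : 0 ≤ ν (i.castSucc, 1) := hν0 _
    have a4 : 0 ≤ ν (i.castSucc, -1) := hν0 _
    have := hdiff i.castSucc
    rcases hz μ hμ i with h | h <;> rcases hz ν hν i with h' | h' <;> constructor <;> linarith
  rw [sum_units_prod, sum_units_prod, Fin.sum_univ_castSucc, Fin.sum_univ_castSucc,
    sum_congr rfl fun i _ => by rw [(hcast i).1, (hcast i).2]] at h1
  have hlast := hdiff (Fin.last d)
  funext ⟨i, s⟩
  rcases Int.units_eq_one_or s with rfl | rfl <;> refine Fin.lastCases ?_ (fun i => ?_) i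
  · linarith
  · exact (hcast i).1
  · linarith
  · exact (hcast i).2

theorem exists_crossFamily_weights {x : Fin (d + 1) → ℝ} (hx : ∑ i, |x i| ≤ 1) :
    ∃ μ : Fin (d + 1) × ℤˣ → ℝ, 0 ≤ μ ∧ ({q | μ q ≠ 0} : Finset _) ∈ crossFamily d ∧
      ∑ q, μ q = 1 ∧ ∑ q, μ q • crossVertex q = x := by
  refine ⟨fun q => max ((q.2 : ℤ) * x q.1) 0 +
    if q.1 = Fin.last d then (1 - ∑ i, |x i|) / 2 else 0, fun q => ?_, fun i => ?_, ?_, ?_⟩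
  · have : 0 ≤ (1 - ∑ i, |x i|) / 2 := by linarith
    simp only [Pi.zero_apply]
    positivity
  · have hne : i.castSucc ≠ Fin.last d := (Fin.castSucc_lt_last i).ne
    simp only [mem_filter, mem_univ, true_and, if_neg hne, add_zero, not_and, not_not]
    intro h
    simp only [Units.val_one, Int.cast_one, one_mul, ne_eq, max_eq_right_iff, not_le,
      Units.val_neg, Int.cast_neg, neg_mul] at h ⊢
    linarith
  · rw [sum_units_prod]
    have : ∀ i, (max ((((1 : ℤˣ) : ℤ) : ℝ) * x i) 0 +
          if i = Fin.last d then (1 - ∑ i, |x i|) / 2 else 0) +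
        (max ((((-1 : ℤˣ) : ℤ) : ℝ) * x i) 0 +
          if i = Fin.last d then (1 - ∑ i, |x i|) / 2 else 0) =
        |x i| + if i = Fin.last d then 1 - ∑ i, |x i| else 0 := fun i => by
      have := max_zero_add_max_neg_zero_eq_abs_self (x i)
      simp only [Units.val_one, Int.cast_one, one_mul, Units.val_neg, Int.cast_neg, neg_mul]
      split_ifs <;> linarith
    rw [sum_congr rfl fun i _ => this i, sum_add_distrib]
    simp
  · funext i
    rw [sum_smul_crossVertex]
    simp

theorem crossPolytope_succ : crossPolytope (d + 1) = {x | ∑ i, |x i| ≤ 1} := by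
  refine Set.Subset.antisymm (fun x hx => sum_abs_le_of_mem_crossPolytope hx) fun x hx => ?_
  obtain ⟨μ, h0, -, h1, rfl⟩ := exists_crossFamily_weights hx
  exact (convex_convexHull ℝ _).sum_mem (fun q _ => h0 q) h1
    fun q _ => single_mem_crossPolytope q.1 q.2

/-- The linear form `∑ (i + 1) x_i`. -/
noncomputable def crossForm (d : ℕ) : (Fin d → ℝ) →ₗ[ℝ] ℝ :=
  ∑ i : Fin d, ((i : ℝ) + 1) • LinearMap.proj i

theorem crossForm_vertex (q : Fin d × ℤˣ) :
    crossForm d (crossVertex q) = ((q.2 : ℤ) : ℝ) * ((q.1 : ℝ) + 1) := by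
  simp [crossForm, crossVertex, LinearMap.sum_apply, Pi.single_apply, mul_comm]

theorem crossForm_injective : Function.Injective (crossForm d ∘ crossVertex) := by
  rintro ⟨i, s⟩ ⟨i', s'⟩ h
  simp only [Function.comp_apply, crossForm_vertex] at h
  have hi : (0 : ℝ) < (i : ℝ) + 1 := by positivity
  have hi' : (0 : ℝ) < (i' : ℝ) + 1 := by positivity
  have heq : (i : ℝ) = i' → i = i' := fun h => Fin.ext (by exact_mod_cast h)
  rcases Int.units_eq_one_or s with rfl | rfl <;> rcases Int.units_eq_one_or s' with rfl | rfl
  · rw [heq (by simpa using h)]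
  · simp at h
    linarith
  · simp at h
    linarith
  · rw [heq ?_]
    simp only [Units.val_neg, Units.val_one, Int.cast_neg, Int.cast_one] at h
    linarith

/-- The vertices of the simplex `crossSimplex a`. -/
def crossIndices (a : Fin d → ℤˣ) : Finset (Fin (d + 1) × ℤˣ) :=
  {(Fin.last d, 1), (Fin.last d, -1)} ∪ univ.image fun i => (i.castSucc, a i)

theorem castSucc_mem_crossIndices {a : Fin d → ℤˣ} {i : Fin d} {s : ℤˣ} :
    (i.castSucc, s) ∈ crossIndices a ↔ s = a i := by
  have hne : i.castSucc ≠ Fin.last d := (Fin.castSucc_lt_last i).ne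
  simp [crossIndices, hne, eq_comm]

theorem last_mem_crossIndices (a : Fin d → ℤˣ) (s : ℤˣ) : (Fin.last d, s) ∈ crossIndices a := by
  rcases Int.units_eq_one_or s with rfl | rfl <;> simp [crossIndices]

theorem crossIndices_mem (a : Fin d → ℤˣ) : crossIndices a ∈ crossFamily d := by
  rintro i ⟨h1, h2⟩
  rw [castSucc_mem_crossIndices] at h1 h2
  exact absurd (h1.trans h2.symm) (by decide)

theorem image_crossIndices (a : Fin d → ℤˣ) : (crossIndices a).image crossVertex =
    crossSimplex a := by
  rw [crossIndices, crossSimplex, image_union, image_insert, image_singleton, image_image]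
  simp [crossVertex, Pi.single_neg, Function.comp_def]

theorem eq_crossIndices_of_subset {a : Fin d → ℤˣ} {D : Finset (Fin (d + 1) × ℤˣ)}
    (hD : D ∈ crossFamily d) (h : crossIndices a ⊆ D) : D = crossIndices a := by
  refine Subset.antisymm ?_ h
  rintro ⟨i, s⟩ hq
  induction i using Fin.lastCases with
  | last => exact last_mem_crossIndices a s
  | cast i =>
    rw [castSucc_mem_crossIndices]
    have h1 : (i.castSucc, a i) ∈ D := h (castSucc_mem_crossIndices.2 rfl)
    by_contra hne
    have hn := hD i
    rcases Int.units_eq_one_or s with rfl | rfl <;>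
      rcases Int.units_eq_one_or (a i) with h2 | h2 <;> rw [h2] at h1 hne <;> tauto

theorem exists_subset_crossIndices {C : Finset (Fin (d + 1) × ℤˣ)} (hC : C ∈ crossFamily d) :
    ∃ a, C ⊆ crossIndices a := by
  refine ⟨fun i => if (i.castSucc, 1) ∈ C then 1 else -1, ?_⟩
  rintro ⟨i, s⟩ hq
  induction i using Fin.lastCases with
  | last => exact last_mem_crossIndices _ s
  | cast i =>
    rw [castSucc_mem_crossIndices]
    have hn := hC i
    rcases Int.units_eq_one_or s with rfl | rfl
    · simp [hq]
    · rw [if_neg]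
      tauto

theorem exists_pointed_triangulation_crossPolytope (d : ℕ) :
    ∃ V K, IsPointedTriangulation (crossPolytope (d + 1)) V K ∧
      K.facets = {s | ∃ a : Fin d → ℤˣ, s = crossSimplex a} := by
  obtain ⟨V, K, hK, hfac⟩ := exists_isPointedTriangulation
    (convex_convexHull ℝ _ : Convex ℝ (crossPolytope (d + 1)))
    (v := crossVertex) (fun q => single_mem_crossPolytope q.1 q.2) (𝒞 := crossFamily d)
    (fun C D h hC i hi => hC i ⟨h hi.1, h hi.2⟩)
    (fun q i hi => by
      rw [mem_singleton, mem_singleton] at hi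
      exact absurd (congrArg Prod.snd (hi.1.trans hi.2.symm)) (by decide : (1 : ℤˣ) ≠ -1))
    hasUniqueWeights_crossFamily
    (fun x hx => exists_crossFamily_weights (sum_abs_le_of_mem_crossPolytope hx))
    (crossForm (d + 1)) crossForm_injective (by
      intro F hF a ha hmin C hC hCF i hi
      have key : ∀ s : ℤˣ, a = (i.castSucc, s) → (i.castSucc, -s) ∉ C := by
        rintro s rfl hs
        have hmid : crossVertex (Fin.last d, -1) + crossVertex (Fin.last d, 1) =
            crossVertex (i.castSucc, s) + crossVertex (i.castSucc, -s) := by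
          simp [crossVertex, ← Pi.single_add]
        have h1 := hmin _ (hF.mem_of_midpoint_mem (single_mem_crossPolytope _ _)
          (single_mem_crossPolytope _ _) ha (hCF _ hs) hmid)
        rw [crossForm_vertex, crossForm_vertex] at h1
        have hid : ((i : ℕ) : ℝ) < d := by exact_mod_cast i.2
        rcases Int.units_eq_one_or s with rfl | rfl <;> simp at h1 <;> linarith
      rw [mem_insert, mem_insert] at hi
      obtain ⟨h1 | h1, h2 | h2⟩ := hi
      · exact absurd (congrArg Prod.snd (h1.trans h2.symm)) (by decide : (1 : ℤˣ) ≠ -1)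
      · exact key 1 h1.symm h2
      · exact key (-1) h2.symm (by simpa using h1)
      · exact hC i ⟨h1, h2⟩)
  refine ⟨V, K, hK, ?_⟩
  rw [hfac]
  ext s
  constructor
  · rintro ⟨C, hC, -, hmax, rfl⟩
    obtain ⟨a, ha⟩ := exists_subset_crossIndices hC
    exact ⟨a, by rw [← hmax _ (crossIndices_mem a) ha, image_crossIndices]⟩
  · rintro ⟨a, rfl⟩
    exact ⟨crossIndices a, crossIndices_mem a, ⟨_, last_mem_crossIndices a 1⟩,
      fun D hD h => eq_crossIndices_of_subset hD h, (image_crossIndices a).symm⟩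

end CrossTriangulation

section SignVectorSums

/-- The number of nonzero entries of a sign vector. -/
def supportCard {d : ℕ} (f : Fin d → SignType) : ℕ := #{i | f i ≠ 0}

theorem supportCard_insertNth {d : ℕ} (p : Fin (d + 1)) (c : SignType) (g : Fin d → SignType) :
    supportCard (Fin.insertNth (α := fun _ => SignType) p c g) =
      supportCard g + if c = 0 then 0 else 1 := by
  simp only [supportCard, card_filter, Fin.sum_univ_succAbove _ p, Fin.insertNth_apply_same,
    Fin.insertNth_apply_succAbove]
  rw [add_comm]
  congr 1
  split_ifs <;> simp_all

theorem sum_signVector_succ {d : ℕ} (p : Fin (d + 1)) (φ : SignType → ℕ → ℕ) :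
    ∑ f : Fin (d + 1) → SignType, φ (f p) (supportCard f) = ∑ g : Fin d → SignType,
      (φ 0 (supportCard g) + φ 1 (supportCard g + 1) + φ (-1) (supportCard g + 1)) := by
  have hins : ∀ c g, Fin.insertNthEquiv (fun _ => SignType) p (c, g) =
      Fin.insertNth (α := fun _ => SignType) p c g := fun _ _ => rfl
  have hsum : ∀ ψ : SignType → ℕ, ∑ c, ψ c = ψ 0 + ψ 1 + ψ (-1) := fun ψ => by
    rw [SignType.univ_eq, sum_insert (by decide), sum_pair (by decide)]
    ring
  rw [← (Fin.insertNthEquiv (fun _ => SignType) p).sum_comp, Fintype.sum_prod_type_right]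
  refine sum_congr rfl fun g _ => ?_
  rw [hsum]
  simp [hins, supportCard_insertNth]

/-- The binomial coefficient `C(m, k - 1)`, taken to be `0` for `k = 0`. -/
def predChoose (m k : ℕ) : ℕ := if k = 0 then 0 else m.choose (k - 1)

theorem predChoose_add_choose (m k : ℕ) : predChoose m k + m.choose k = (m + 1).choose k := by
  cases k with
  | zero => simp [predChoose]
  | succ k => simp [predChoose, Nat.choose_succ_succ]

theorem sum_predChoose_of_ne {d m : ℕ} (p : Fin (d + 1)) {s : SignType} (hs : s ≠ 0) :
    ∑ f : Fin (d + 1) → SignType, (if f p = s then 0 else predChoose m (supportCard f)) =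
      ∑ g : Fin d → SignType, (m + 1).choose (supportCard g) := by
  rw [sum_signVector_succ p fun c k => if c = s then 0 else predChoose m k]
  refine sum_congr rfl fun g _ => ?_
  rw [← predChoose_add_choose]
  rcases s with _ | _ | _
  · exact absurd rfl hs
  · simp [predChoose]
  · simp [predChoose]

theorem sum_choose_supportCard_succ (d m : ℕ) :
    ∑ f : Fin (d + 1) → SignType, (m + 1).choose (supportCard f) =
      ∑ f : Fin (d + 1) → SignType, m.choose (supportCard f) +
        (∑ g : Fin d → SignType, (m + 1).choose (supportCard g) +
          ∑ g : Fin d → SignType, m.choose (supportCard g)) := by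
  simp only [← predChoose_add_choose]
  rw [sum_add_distrib, add_comm, sum_signVector_succ 0 fun _ k => predChoose m k,
    ← sum_add_distrib]
  congr 1

theorem sum_choose_mul_choose_succ (d m : ℕ) :
    ∑ i ∈ range (d + 2), (d + 1).choose i * (m + 1 + (d + 1) - i).choose (d + 1) =
      ∑ i ∈ range (d + 2), (d + 1).choose i * (m + (d + 1) - i).choose (d + 1) +
        (∑ i ∈ range (d + 1), d.choose i * (m + 1 + d - i).choose d +
          ∑ i ∈ range (d + 1), d.choose i * (m + d - i).choose d) := by
  have h1 : ∀ i ∈ range (d + 2), (d + 1).choose i * (m + 1 + (d + 1) - i).choose (d + 1) =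
      (d + 1).choose i * (m + (d + 1) - i).choose (d + 1) +
        (d + 1).choose i * (m + (d + 1) - i).choose d := fun i hi => by
    have := mem_range.1 hi
    rw [show m + 1 + (d + 1) - i = m + (d + 1) - i + 1 by omega, Nat.choose_succ_succ]
    ring
  rw [sum_congr rfl h1, sum_add_distrib]
  congr 1
  have h2 : ∀ i, m + (d + 1) - (i + 1) = m + d - i := fun i => by omega
  have h3 : ∀ i, m + 1 + d - (i + 1) = m + d - i := fun i => by omega
  have h4 : ∑ i ∈ range (d + 1), d.choose i * (m + 1 + d - i).choose d =
      ∑ i ∈ range (d + 1), d.choose (i + 1) * (m + d - i).choose d + (m + 1 + d).choose d := by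
    have := sum_range_succ (fun i => d.choose i * (m + 1 + d - i).choose d) (d + 1)
    simp only [Nat.choose_succ_self, zero_mul, add_zero] at this
    rw [← this, sum_range_succ']
    simp [h3]
  rw [h4, sum_range_succ']
  simp only [Nat.choose_succ_succ d, add_mul, sum_add_distrib, h2]
  rw [Nat.choose_zero_right, one_mul, Nat.sub_zero, show m + (d + 1) = m + 1 + d by ring]
  ring

theorem sum_choose_supportCard (d m : ℕ) : ∑ f : Fin d → SignType, m.choose (supportCard f) =
    ∑ i ∈ range (d + 1), d.choose i * (m + d - i).choose d := by
  induction d generalizing m with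
  | zero => simp [supportCard]
  | succ d ihd =>
    induction m with
    | zero =>
      have hR : ∀ i ∈ range (d + 1),
          (d + 1).choose (i + 1) * (0 + (d + 1) - (i + 1)).choose (d + 1) = 0 := fun i _ => by
        rw [Nat.choose_eq_zero_of_lt (by omega : 0 + (d + 1) - (i + 1) < d + 1), mul_zero]
      rw [sum_range_succ', sum_eq_zero hR, sum_eq_single 0]
      · simp [supportCard]
      · intro f _ hf
        refine Nat.choose_eq_zero_of_lt (card_pos.2 ?_)
        obtain ⟨i, hi⟩ := Function.ne_iff.1 hf
        exact ⟨i, by simpa using hi⟩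
      · simp
    | succ m ihm => rw [sum_choose_supportCard_succ, sum_choose_mul_choose_succ, ihm, ihd, ihd]

end SignVectorSums

section CrossFaces

variable {d : ℕ}

/-- The simplex with vertices `f i • e i`, `f i ≠ 0`. -/
def crossFace (f : Fin d → SignType) : Set (Fin d → ℝ) :=
  {x | (∀ i, (f i : ℝ) * x i = |x i|) ∧ ∑ i, |x i| = 1}

theorem sign_cast_mul_le (s : SignType) (x : ℝ) : (s : ℝ) * x ≤ |x| := by
  rcases s with _ | _ | _
  · simp
  · simpa using neg_le_abs x
  · simpa using le_abs_self x

theorem sign_cast_mul_self {s : SignType} (hs : s ≠ 0) : (s : ℝ) * s = 1 := by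
  rcases s with _ | _ | _
  · exact absurd rfl hs
  · simp
  · simp

theorem abs_sign_cast {s : SignType} (hs : s ≠ 0) : |(s : ℝ)| = 1 := by
  rcases s with _ | _ | _
  · exact absurd rfl hs
  · simp
  · simp

theorem single_mem_crossFace_iff {f : Fin d → SignType} {i : Fin d} {s : SignType} (hs : s ≠ 0) :
    Pi.single i (s : ℝ) ∈ crossFace f ↔ f i = s := by
  have hsum : ∀ k, |(Pi.single i (s : ℝ) : Fin d → ℝ) k| = if k = i then 1 else 0 := fun k => by
    rw [Pi.single_apply]
    split_ifs <;> simp [abs_sign_cast hs]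
  constructor
  · rintro ⟨h, -⟩
    have hi := h i
    rw [hsum, Pi.single_eq_same, if_pos rfl] at hi
    generalize f i = t at hi
    rcases s with _ | _ | _ <;> rcases t with _ | _ | _ <;> first | rfl | norm_num at hi
  · rintro rfl
    refine ⟨fun k => ?_, ?_⟩
    · rw [hsum]
      split_ifs with hk
      · subst hk
        simpa using sign_cast_mul_self hs
      · simp [hk]
    · rw [sum_congr rfl fun k _ => hsum k]
      simp

theorem crossFace_injective : Function.Injective (crossFace (d := d)) := by
  intro f g h
  funext i
  have key : ∀ s : SignType, s ≠ 0 → (f i = s ↔ g i = s) := fun s hs => by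
    rw [← single_mem_crossFace_iff hs, h, single_mem_crossFace_iff hs]
  by_cases hf : f i = 0
  · by_contra hne
    exact hne (hf ▸ ((key (g i) fun h0 => hne (hf.trans h0.symm)).2 rfl))
  · exact ((key (f i) hf).1 rfl).symm

theorem crossFace_nonempty {f : Fin d → SignType} (hf : f ≠ 0) : (crossFace f).Nonempty := by
  obtain ⟨i, hi⟩ := Function.ne_iff.1 hf
  exact ⟨_, (single_mem_crossFace_iff hi).2 rfl⟩

theorem isFace_crossFace {f : Fin (d + 1) → SignType} (hf : f ≠ 0) :
    IsFace (crossPolytope (d + 1)) (crossFace f) := by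
  have hne := crossFace_nonempty hf
  refine ⟨fun _ => ⟨∑ i, (f i : ℝ) • ContinuousLinearMap.proj i, ?_⟩, hne⟩
  have hl : ∀ x : Fin (d + 1) → ℝ,
      (∑ i, (f i : ℝ) • ContinuousLinearMap.proj (R := ℝ) (φ := fun _ : Fin (d + 1) => ℝ) i) x =
        ∑ i, (f i : ℝ) * x i := fun x => by simp
  simp only [hl, crossPolytope_succ]
  ext x
  constructor
  · rintro ⟨h1, h2⟩
    refine ⟨h2.le, fun y hy => ?_⟩
    rw [sum_congr rfl fun i _ => h1 i, h2]
    exact (sum_le_sum fun i _ => sign_cast_mul_le (f i) (y i)).trans hy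
  · rintro ⟨hx, hmax⟩
    obtain ⟨y, hy1, hy2⟩ := hne
    have h1 := hmax y hy2.le
    rw [sum_congr rfl fun i _ => hy1 i, hy2] at h1
    have h2 : ∑ i, (f i : ℝ) * x i ≤ ∑ i, |x i| := sum_le_sum fun i _ => sign_cast_mul_le _ _
    have h3 : ∑ i, |x i| = 1 := le_antisymm hx (h1.trans h2)
    have h4 : ∑ i, (f i : ℝ) * x i = ∑ i, |x i| := le_antisymm h2 (h3.trans_le h1)
    rw [sum_eq_sum_iff_of_le fun i _ => sign_cast_mul_le _ _] at h4
    exact ⟨fun i => h4 i (mem_univ i), h3⟩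

theorem isFace_crossPolytope_iff {F : Set (Fin (d + 1) → ℝ)} :
    IsFace (crossPolytope (d + 1)) F ↔
      F = crossPolytope (d + 1) ∨ ∃ f : Fin (d + 1) → SignType, f ≠ 0 ∧ F = crossFace f := by
  constructor
  · intro hF
    obtain ⟨l, rfl⟩ := hF.exists_eq
    set g : Fin (d + 1) → ℝ := fun i => l (Pi.single i 1) with hg
    have hl : ∀ x, l x = ∑ i, g i * x i := fun x => by
      conv_lhs => rw [pi_eq_sum_univ' x]
      simp [hg, mul_comm, map_sum]
    obtain ⟨i₀, -, hi₀⟩ := exists_max_image univ (fun i => |g i|) univ_nonempty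
    have hM : ∀ i, |g i| ≤ |g i₀| := fun i => hi₀ i (mem_univ i)
    have hterm : ∀ x : Fin (d + 1) → ℝ, ∀ i, g i * x i ≤ |g i₀| * |x i| := fun x i =>
      (le_abs_self _).trans (by rw [abs_mul]; exact mul_le_mul_of_nonneg_right (hM i) (abs_nonneg _))
    have hle : ∀ x ∈ crossPolytope (d + 1), l x ≤ |g i₀| := fun x hx => by
      rw [hl]
      refine (sum_le_sum fun i _ => hterm x i).trans ?_
      rw [← mul_sum]
      exact mul_le_of_le_one_right (abs_nonneg _) (sum_abs_le_of_mem_crossPolytope hx)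
    rcases eq_or_ne (g i₀) 0 with h0 | h0
    · left
      have hg0 : ∀ i, g i = 0 := fun i => abs_eq_zero.1 (le_antisymm (by simpa [h0] using hM i)
        (abs_nonneg _))
      ext x
      simp [hl, hg0]
    · right
      have hpos : 0 < |g i₀| := abs_pos.2 h0
      let f : Fin (d + 1) → SignType := fun i => if |g i| = |g i₀| then SignType.sign (g i) else 0
      have hf : f ≠ 0 := fun h => by simpa [f, h0] using congrFun h i₀
      have hiff : ∀ x : Fin (d + 1) → ℝ, ∀ i, g i * x i = |g i₀| * |x i| ↔
          (f i : ℝ) * x i = |x i| := fun x i => by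
        by_cases hi : |g i| = |g i₀|
        · have : g i = |g i₀| * (f i : ℝ) := by
            simp only [f, if_pos hi]
            rw [← hi, mul_comm, sign_mul_abs]
          rw [this, mul_assoc]
          exact mul_right_inj' hpos.ne'
        · have hlt : |g i| < |g i₀| := lt_of_le_of_ne (hM i) hi
          simp only [f, if_neg hi, SignType.coe_zero, zero_mul]
          constructor
          · intro h
            have h1 : |g i₀| * |x i| ≤ |g i| * |x i| := by
              rw [← h, ← abs_mul]
              exact le_abs_self _
            by_contra hne
            have h2 : 0 < |x i| := lt_of_le_of_ne (abs_nonneg _) hne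
            exact absurd (le_of_mul_le_mul_right h1 h2) (not_le.2 hlt)
          · intro h
            rw [← h, abs_eq_zero.1 h.symm]
            simp
      refine ⟨f, hf, ?_⟩
      have hval : ∀ x ∈ crossFace f, l x = |g i₀| := fun x hx => by
        rw [hl, sum_congr rfl fun i _ => (hiff x i).2 (hx.1 i), ← mul_sum, hx.2, mul_one]
      ext x
      constructor
      · rintro ⟨hx, hmax⟩
        obtain ⟨y, hy⟩ := crossFace_nonempty hf
        have h1 := hmax y ((isFace_crossFace hf).1.subset hy)
        rw [hval y hy, hl] at h1
        have hx1 := sum_abs_le_of_mem_crossPolytope hx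
        have h2 : ∑ i, g i * x i ≤ ∑ i, |g i₀| * |x i| := sum_le_sum fun i _ => hterm x i
        have h3 : ∑ i, |g i₀| * |x i| ≤ |g i₀| := by
          rw [← mul_sum]
          exact mul_le_of_le_one_right hpos.le hx1
        have h4 := le_antisymm h2 (h3.trans h1)
        rw [sum_eq_sum_iff_of_le fun i _ => hterm x i] at h4
        refine ⟨fun i => (hiff x i).1 (h4 i (mem_univ i)), ?_⟩
        have h5 : |g i₀| * ∑ i, |x i| = |g i₀| := by
          rw [mul_sum]
          exact le_antisymm h3 (h1.trans h2)
        exact (mul_eq_left₀ hpos.ne').1 h5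
      · intro hx
        exact ⟨(isFace_crossFace hf).1.subset hx, fun y hy => by
          rw [hval x hx]
          exact hle y hy⟩
  · rintro (rfl | ⟨f, hf, rfl⟩)
    · exact ⟨IsExposed.refl _, ⟨_, single_mem_crossPolytope 0 1⟩⟩
    · exact isFace_crossFace hf

theorem isProperFace_crossPolytope_iff {F : Set (Fin (d + 1) → ℝ)} :
    IsProperFace (crossPolytope (d + 1)) F ↔
      ∃ f ∈ (univ.erase 0 : Finset (Fin (d + 1) → SignType)), F = crossFace f := by
  rw [IsProperFace, isFace_crossPolytope_iff]
  constructor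
  · rintro ⟨rfl | ⟨f, hf, rfl⟩, hne⟩
    · exact absurd rfl hne
    · exact ⟨f, by simpa using hf, rfl⟩
  · rintro ⟨f, hf, rfl⟩
    refine ⟨.inr ⟨f, by simpa using hf, rfl⟩, fun h => ?_⟩
    have h0 : (0 : Fin (d + 1) → ℝ) ∈ crossFace f := by
      rw [h, crossPolytope_succ]
      simp
    simpa using h0.2

/-- The facet of the cross polytope in the orthant of the sign vector `s`. -/
noncomputable def orthantParam {s : Fin d → SignType} (hs : ∀ i, s i ≠ 0) :
    SimplexProductParam (fun _ : Unit => Fin d) (Fin d → ℝ) where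
  toLin := LinearMap.pi fun i => (s i : ℝ) •
    (LinearMap.proj (R := ℝ) (φ := fun _ => ℝ) i ∘ₗ
      LinearMap.proj (R := ℝ) (φ := fun _ : Unit => Fin d → ℝ) ())
  coord _ k := (s k : ℝ) • ContinuousLinearMap.proj k
  off _ _ := 0
  coord_toLin c _ j k := by
    simp [← mul_assoc, sign_cast_mul_self (hs k)]

theorem orthantParam_apply {s : Fin d → SignType} (hs : ∀ i, s i ≠ 0) (c : Unit → Fin d → ℝ)
    (i : Fin d) : (orthantParam hs).toLin c i = s i * c () i := rfl

theorem orthantParam_face {s : Fin d → SignType} (hs : ∀ i, s i ≠ 0)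
    (T : Unit → Finset (Fin d)) :
    (orthantParam hs).face T = crossFace fun i => if i ∈ T () then s i else 0 := by
  ext x
  constructor
  · rintro ⟨c, hc, rfl⟩
    have h1 : ∀ i, |(orthantParam hs).toLin c i| = c () i := fun i => by
      rw [orthantParam_apply, abs_mul, abs_sign_cast (hs i), one_mul, abs_of_nonneg ((hc ()).1.1 i)]
    refine ⟨fun i => ?_, ?_⟩
    · rw [h1, orthantParam_apply]
      beta_reduce
      split_ifs with hi
      · rw [← mul_assoc, sign_cast_mul_self (hs i), one_mul]
      · simp [(hc ()).2 i hi]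
    · rw [sum_congr rfl fun i _ => h1 i]
      exact (hc ()).1.2
  · rintro ⟨h1, h2⟩
    refine ⟨fun _ i => |x i|, fun _ => ⟨⟨fun i => abs_nonneg _, h2⟩, fun i hi => ?_⟩, ?_⟩
    · have := h1 i
      beta_reduce at this
      rw [if_neg hi] at this
      simpa using this.symm
    · funext i
      rw [orthantParam_apply, ← h1]
      beta_reduce
      split_ifs with hi
      · rw [← mul_assoc, sign_cast_mul_self (hs i), one_mul]
      · have := h1 i
        beta_reduce at this
        rw [if_neg hi] at this
        have h0 : x i = 0 := by simpa using this.symm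
        simp [h0]

theorem polytopeNumberPair_crossFace {V : Set (Fin (d + 1) → ℝ) → Fin (d + 1) → ℝ}
    (hV : IsApexAssignment (crossPolytope (d + 1)) V) {f : Fin (d + 1) → SignType} (hf : f ≠ 0)
    (n : ℕ) : (polytopeNumberPair V (crossFace f) (n + 2)).2 = (predChoose n (supportCard f) : ℕ) := by
  let s : Fin (d + 1) → SignType := fun i => if f i = 0 then 1 else f i
  have hs : ∀ i, s i ≠ 0 := fun i => by
    simp only [s]
    split_ifs with h
    exacts [by decide, h]
  let T : Unit → Finset (Fin (d + 1)) := fun _ => {i | f i ≠ 0}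
  have hT : ∀ j, (T j).Nonempty := fun j => by
    obtain ⟨i, hi⟩ := Function.ne_iff.1 hf
    exact ⟨i, by simpa [T] using hi⟩
  have hfT : crossFace f = (orthantParam hs).face T := by
    rw [orthantParam_face]
    congr 1
    funext i
    simp only [T, s, mem_filter, mem_univ, true_and]
    split_ifs <;> simp_all
  have hVs : IsApexAssignment (orthantParam hs).polytope V := by
    intro G hG
    rw [← (orthantParam hs).face_univ, (orthantParam hs).isFace_face_iff fun _ => univ_nonempty] at hG
    obtain ⟨S, -, hS, rfl⟩ := hG
    refine hV _ ?_
    rw [orthantParam_face]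
    refine isFace_crossFace fun h => ?_
    obtain ⟨i, hi⟩ := hS ()
    have := congrFun h i
    rw [if_pos hi] at this
    exact hs i this
  rw [hfT, (orthantParam hs).polytopeNumberPair_face hVs T hT]
  have hcard : #(T ()) = supportCard f := rfl
  have hpos : supportCard f ≠ 0 := (card_pos.2 (hT ())).ne'
  simp [hcard, predChoose, hpos]

theorem apex_crossPolytope {V : Set (Fin (d + 1) → ℝ) → Fin (d + 1) → ℝ}
    (hV : IsApexAssignment (crossPolytope (d + 1)) V) :
    ∃ i, ∃ s : SignType, s ≠ 0 ∧ V (crossPolytope (d + 1)) = Pi.single i (s : ℝ) := by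
  have h := hV _ (isFace_crossPolytope_iff.2 (.inl rfl))
  rcases extremePoints_convexHull_subset h with ⟨i, hi⟩ | ⟨i, hi⟩
  · exact ⟨i, 1, by decide, by simpa using hi.symm⟩
  · exact ⟨i, -1, by decide, by simpa [Pi.single_neg] using hi.symm⟩

theorem polytopeDim_crossPolytope_ne_zero : polytopeDim (crossPolytope (d + 1)) ≠ 0 := by
  rw [Ne, polytopeDim_eq_zero_iff]
  intro h
  have := congrFun (h (single_mem_crossPolytope (0 : Fin (d + 1)) 1)
    (single_mem_crossPolytope 0 (-1))) 0
  norm_num at this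

theorem polytopeNumber_crossPolytope_add_two {V : Set (Fin (d + 1) → ℝ) → Fin (d + 1) → ℝ}
    (hV : IsApexAssignment (crossPolytope (d + 1)) V) (n : ℕ) :
    polytopeNumber V (crossPolytope (d + 1)) (n + 2) =
      polytopeNumber V (crossPolytope (d + 1)) (n + 1) +
        (∑ i ∈ range (d + 1), d.choose i * (n + 1 + d - i).choose d : ℕ) := by
  classical
  obtain ⟨p, s, hs, hp⟩ := apex_crossPolytope hV
  rw [polytopeNumber, polytopeNumber,
    polytopeNumberPair_add_two_fst _ _ polytopeDim_crossPolytope_ne_zero,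
    finsum_isProperFace_eq crossFace_injective.injOn (fun F => isProperFace_crossPolytope_iff)
      fun F => if V (crossPolytope (d + 1)) ∈ F then 0 else (polytopeNumberPair V F (n + 2)).2,
    ← sum_choose_supportCard, ← sum_predChoose_of_ne p hs, hp]
  congr 1
  push_cast
  rw [← add_sum_erase _ _ (mem_univ (0 : Fin (d + 1) → SignType))]
  have h0 : supportCard (0 : Fin (d + 1) → SignType) = 0 := by simp [supportCard]
  rw [h0, predChoose, if_pos rfl]
  simp only [Nat.cast_zero, ite_self, zero_add]
  refine sum_congr rfl fun f hf => ?_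
  rw [polytopeNumberPair_crossFace hV (mem_erase.1 hf).1]
  simp only [single_mem_crossFace_iff hs]

theorem polytopeNumber_crossPolytope {V : Set (Fin (d + 1) → ℝ) → Fin (d + 1) → ℝ}
    (hV : IsApexAssignment (crossPolytope (d + 1)) V)
    {W : Set (Fin (d + 1 + 1) → ℝ) → Fin (d + 1 + 1) → ℝ}
    (hW : IsApexAssignment (stdSimplex ℝ (Fin (d + 1 + 1))) W) (n : ℕ) :
    polytopeNumber V (crossPolytope (d + 1)) n = ∑ i ∈ range (d + 1),
      (d.choose i : ℤ) * polytopeNumber W (stdSimplex ℝ (Fin (d + 1 + 1))) (n - i) := by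
  have hα : ∀ n, ∀ i ∈ range (d + 1), polytopeNumber W (stdSimplex ℝ (Fin (d + 1 + 1)))
      (n + 1 - i) = ((n + (d + 1) - i).choose (d + 1) : ℕ) := fun n i hi => by
    have := mem_range.1 hi
    by_cases h : i ≤ n
    · rw [show n + 1 - i = (n - i) + 1 by omega, polytopeNumber_stdSimplex hW,
        show n - i + (d + 1) = n + (d + 1) - i by omega]
    · rw [show n + 1 - i = 0 by omega, polytopeNumber_zero, Nat.choose_eq_zero_of_lt (by omega)]
      rfl
  induction n with
  | zero => simp [polytopeNumber_zero]
  | succ n ih =>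
    cases n with
    | zero =>
      rw [sum_congr rfl fun i hi => by rw [hα 0 i hi], polytopeNumber, zero_add,
        polytopeNumberPair_one _ _ polytopeDim_crossPolytope_ne_zero, sum_range_succ',
        sum_eq_zero fun i _ => by
          rw [Nat.choose_eq_zero_of_lt (by omega : 0 + (d + 1) - (i + 1) < d + 1)]; simp]
      simp
    | succ n =>
      rw [polytopeNumber_crossPolytope_add_two hV, ih]
      push_cast
      rw [← sum_add_distrib]
      refine sum_congr rfl fun i hi => ?_
      have := mem_range.1 hi
      rw [hα n i hi, hα (n + 1) i hi, show n + 1 + (d + 1) - i = n + 1 + d - i + 1 by omega,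
        show n + (d + 1) - i = n + 1 + d - i by omega, Nat.choose_succ_succ]
      push_cast
      ring

end CrossFaces

theorem mainTheorem11 :
    -- cross polytopes of dimension `d + 1 ≥ 1`
    (∀ d : ℕ,
      (∃ V K, IsPointedTriangulation (crossPolytope (d + 1)) V K ∧
        K.facets = {s | ∃ a : Fin d → ℤˣ, s = crossSimplex a}) ∧
      ∀ V, IsApexAssignment (crossPolytope (d + 1)) V →
      ∀ W, IsApexAssignment (stdSimplex ℝ (Fin (d + 1 + 1))) W →
      ∀ n : ℕ, polytopeNumber V (crossPolytope (d + 1)) n =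
        ∑ i ∈ Finset.range (d + 1),
          (d.choose i : ℤ) * polytopeNumber W (stdSimplex ℝ (Fin (d + 1 + 1))) (n - i)) ∧
    -- measure polytopes of dimension `d ≥ 1`
    (∀ d : ℕ, 1 ≤ d → ∀ a b : Fin d → ℝ, (∀ i, a i < b i) →
      (∃ V K, IsPointedTriangulation (measurePolytope a b) V K ∧
        K.facets = {s | ∃ σ : Equiv.Perm (Fin d), s = boxSimplex a b σ}) ∧
      ∀ V, IsApexAssignment (measurePolytope a b) V →
      ∀ W, IsApexAssignment (stdSimplex ℝ (Fin (d + 1))) W →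
      ∀ n : ℕ, polytopeNumber V (measurePolytope a b) n =
        ∑ i ∈ Finset.range d,
          (eulerianNumber d i : ℤ) * polytopeNumber W (stdSimplex ℝ (Fin (d + 1))) (n - i)) ∧
    -- products of simplices of total dimension `d_1 + ⋯ + d_l ≥ 1`
    (∀ (l : ℕ) (d : Fin l → ℕ), 1 ≤ ∑ j, d j →
      (∃ V K, IsPointedTriangulation (simplexProduct d) V K ∧
        K.facets = {s | ∃ w, IsMultisetPerm d w ∧ s = productSimplex d w}) ∧
      ∀ V, IsApexAssignment (simplexProduct d) V →
      ∀ W, IsApexAssignment (stdSimplex ℝ (Fin ((∑ j, d j) + 1))) W →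
      ∀ n : ℕ, polytopeNumber V (simplexProduct d) n =
        ∑ i ∈ Finset.range (∑ j, d j),
          (generalizedEulerianNumber d i : ℤ) *
            polytopeNumber W (stdSimplex ℝ (Fin ((∑ j, d j) + 1))) (n - i)) := by
  exact ⟨fun d => ⟨exists_pointed_triangulation_crossPolytope d,
      fun _ hV _ hW n => polytopeNumber_crossPolytope hV hW n⟩,
    fun _ hd _ _ h => ⟨exists_pointed_triangulation_measurePolytope hd h,
      fun _ hV _ hW n => polytopeNumber_measurePolytope hd h hV hW n⟩,
    fun _ d hd => ⟨exists_pointed_triangulation_simplexProduct d hd,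
      fun _ hV _ hW n => polytopeNumber_simplexProduct d hd hV hW n⟩⟩
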